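/- **Setting.** Fix $\rho>1$. Let $\mathcal W_\rho$ be the Banach space of loops $h=\sum_{k\in\mathbb Z}h_k\lambda^k$ on $\mathbb S^1$ with $\|h\|_\rho=\sum_k|h_k|\rho^{|k|}<\infty$, and let $\mathcal W^{\ge0}_{\mathbb R,\rho}$ be the real subspace of those $h$ with $h_k\in\mathbb R$ for all $k$ and $h_k=0$ for $k<0$. Write $h^*(\lambda)=\overline{h(1/\overline\lambda)}$. Let $\varphi\in(0,\frac\pi2)$ and $$p_1=e^{i\varphi},\quad p_2=-e^{-i\varphi},\quad p_3=-e^{i\varphi},\quad p_4=e^{-i\varphi},\qquad \Sigma=\mathbb{CP}^1\setminus\{p_1,\dots,p_4\}.$$ For a parameter vector $\mathbf x=(\tilde a,\tilde b,\tilde c,r,\theta)\in(\mathcal W^{\ge0}_{\mathbb R,\rho})^3\times\mathbb R^2$ put $$a=\tfrac12(\lambda^{-1}-\lambda)+\tilde a,\qquad b=-\tfrac12\sin(\varphi)(\lambda^{-1}+\lambda)+\tilde b,\qquad c=-\tfrac12\cos(\varphi)(\lambda^{-1}+\lambda)+\tilde c,$$ $$A_1=\begin{pmatrix}ia&b+ic\\b-ic&-ia\end{pmatrix},\quad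 A_2=\begin{pmatrix}-ia&-b+ic\\-b-ic&ia\end{pmatrix},\quad A_3=\begin{pmatrix}ia&-b-ic\\-b+ic&-ia\end{pmatrix},\quad A_4=\begin{pmatrix}-ia&b-ic\\b+ic&ia\end{pmatrix},$$ and for $t\in\mathbb R$ let $$\eta^{\mathbf x}_{t,\varphi}=r\,t\sum_{k=1}^4A_k(\lambda)\frac{dz}{z-p_k}.$$ The central value is $\underline{\mathbf x}=(0,0,0,1,\frac\pi2)$. For $\lambda\in\mathbb S^1$ let $\Phi$ solve $d\Phi=\Phi\,\eta^{\mathbf x}_{t,\varphi}$, $\Phi(0)=\mathrm{Id}$, along the straight segments from $0$ to $1$ and from $0$ to $i$; let $\mathcal P=\Phi(1)$, $\mathcal Q=\Phi(i)$ and $$\mathfrak p=\mathcal P_{11}\mathcal P_{21}-\mathcal P_{12}\mathcal P_{22},\qquad \mathfrak q=i(\mathcal Q_{11}\mathcal Q_{21}+\mathcal Q_{12}\mathcal Q_{22}).$$ For fixed $\mathbf x$ and $\lambda$, and a function $f$ of $t$, let $\widehat f(t)=(f(t)-f(0))/t$ for $t\ne0$ and $\widehat f(0)=f'(0)$. Put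 $$\mathcal F=\widehat{\mathfrak p}-\widehat{\mathfrak p}^{\,*},\quad \mathcal G=\widehat{\mathfrak q}-\widehat{\mathfrak q}^{\,*},\quad \mathcal K=\det(rA_1),\quad \mathcal H_1=\widehat{\mathfrak p}|_{\lambda=e^{i\theta}},\quad \mathcal H_2=\widehat{\mathfrak q}|_{\lambda=e^{i\theta}}.$$ The pair $(t,\mathbf x)$ *solves the monodromy problem* if $\mathcal F=\mathcal G=0$ and $\mathcal K=-1$ on $\mathbb S^1$, $\theta\in(0,\pi)$, and $\mathcal H_1=\mathcal H_2=0$. **Proposition.** For every $\varphi\in(0,\frac\pi2)$ there are $\varepsilon>0$, a neighbourhood $U$ of $\underline{\mathbf x}$ in $(\mathcal W^{\ge0}_{\mathbb R,\rho})^3\times\mathbb R^2$ and a family $\mathbf x(t)\in U$, real analytic in $t\in(-\varepsilon,\varepsilon)$, with $\mathbf x(0)=\underline{\mathbf x}$, such that for every $t\in(-\varepsilon,\varepsilon)$ the pair $(t,\mathbf x(t))$ solves the monodromy problem, and $\mathbf x(t)$ is the only $\mathbf y\in U$ for which $(t,\mathbf y)$ solves it. The potentials $\eta_t=\eta^{\mathbf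 x(t)}_{t,\varphi}$ are symmetric: $$\delta^*\eta_t=D^{-1}\eta_tD,\qquad \tau^*\eta_t=C^{-1}\eta_tC,\qquad \sigma^*\overline{\eta_t(\cdot,\overline\lambda)}=\eta_t(\cdot,\lambda),$$ where $\delta(z)=-z$, $\tau(z)=1/z$, $\sigma(z)=\overline z$, $D=\begin{pmatrix}i&0\\0&-i\end{pmatrix}$, $C=\begin{pmatrix}0&i\\i&0\end{pmatrix}$. For $t\ne0$ they are DPW potentials on $\Sigma$ (at $t=0$ the potential is $0$): $\eta_t$ is a holomorphic $(1,0)$-form on $\Sigma$ with values in the real analytic loops in $\mathfrak{sl}(2,\mathbb C)$, $\lambda\eta_t$ extends holomorphically in $\lambda$ to the closed unit disc, and its value at $\lambda=0$ is nilpotent and nowhere zero on $\Sigma$. -/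

import Mathlib

open Complex Set Topology
open scoped ComplexConjugate

noncomputable section

namespace DPW

/-! ## Loops: the Wiener-type spaces `W_ρ` -/

/-- Fourier coefficients `(h_k)_{k ∈ ℤ}` of a loop `h = ∑ h_k λ^k`.  (A type synonym, so that no
product topology is attached to it.) -/
def Coeffs : Type := ℤ → ℂ

instance : AddCommGroup Coeffs := inferInstanceAs (AddCommGroup (ℤ → ℂ))
instance : Module ℝ Coeffs := inferInstanceAs (Module ℝ (ℤ → ℂ))

/-- The `k`-th Fourier coefficient. -/
def Coeffs.coeff (h : Coeffs) (k : ℤ) : ℂ := h k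

@[simp] theorem Coeffs.coeff_zero (k : ℤ) : (0 : Coeffs).coeff k = 0 := rfl
@[simp] theorem Coeffs.coeff_add (f g : Coeffs) (k : ℤ) :
    (f + g).coeff k = f.coeff k + g.coeff k := rfl
@[simp] theorem Coeffs.coeff_smul (r : ℝ) (f : Coeffs) (k : ℤ) :
    (r • f).coeff k = r • f.coeff k := rfl

/-- `W_ρ`: the loops with `∑ |h_k| ρ^|k| < ∞`, as a real vector space. -/
def W (ρ : ℝ) : Submodule ℝ Coeffs where
  carrier := {h | Summable fun k : ℤ => ‖h.coeff k‖ * |ρ| ^ k.natAbs}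
  zero_mem' := by
    simp
  add_mem' := by
    intro f g hf hg
    refine Summable.of_nonneg_of_le (fun k => by positivity) (fun k => ?_) (hf.add hg)
    rw [Coeffs.coeff_add, ← add_mul]
    exact mul_le_mul_of_nonneg_right (norm_add_le _ _) (by positivity)
  smul_mem' := by
    intro r f hf
    refine (hf.mul_left |r|).congr (fun k => ?_)
    rw [Coeffs.coeff_smul, norm_smul, Real.norm_eq_abs, mul_assoc]

/-- `‖h‖_ρ = ∑ |h_k| ρ^|k|`. -/
instance (ρ : ℝ) : Norm (W ρ) :=
  ⟨fun h => ∑' k : ℤ, ‖h.1.coeff k‖ * |ρ| ^ k.natAbs⟩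

theorem W.norm_def (ρ : ℝ) (h : W ρ) :
    ‖h‖ = ∑' k : ℤ, ‖h.1.coeff k‖ * |ρ| ^ k.natAbs := rfl

theorem W.core (ρ : ℝ) [hρ : Fact (1 < ρ)] : NormedSpace.Core ℝ (W ρ) where
  norm_nonneg h := tsum_nonneg fun k => by positivity
  norm_smul r h := by
    rw [W.norm_def, W.norm_def, Real.norm_eq_abs, ← tsum_mul_left]
    refine tsum_congr fun k => ?_
    rw [Submodule.coe_smul, Coeffs.coeff_smul, norm_smul, Real.norm_eq_abs, mul_assoc]
  norm_triangle f g := by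
    rw [W.norm_def, W.norm_def, W.norm_def, ← Summable.tsum_add f.2 g.2]
    refine Summable.tsum_le_tsum (fun k => ?_) (f + g).2 (f.2.add g.2)
    rw [Submodule.coe_add, Coeffs.coeff_add, ← add_mul]
    exact mul_le_mul_of_nonneg_right (norm_add_le _ _) (by positivity)
  norm_eq_zero_iff h := by
    have hpos : 0 < |ρ| := abs_pos.2 (by linarith [hρ.out])
    constructor
    · intro h0
      rw [W.norm_def] at h0
      have h1 := (hasSum_zero_iff_of_nonneg (fun k => by positivity)).1 (h0 ▸ h.2.hasSum)
      refine Subtype.ext (funext fun k => ?_)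
      have h2 : h.1.coeff k = 0 := by simpa [hpos.ne'] using congrFun h1 k
      exact h2
    · rintro rfl
      simp [W.norm_def]

instance (ρ : ℝ) [Fact (1 < ρ)] : NormedAddCommGroup (W ρ) :=
  NormedAddCommGroup.ofCore (W.core ρ)

instance (ρ : ℝ) [Fact (1 < ρ)] : NormedSpace ℝ (W ρ) :=
  NormedSpace.ofCore (W.core ρ)

/-- `W_{ℝ,ρ}^{≥0}`: only nonnegative powers of `λ`, and `h = \bar h` (where
`\bar h(λ) = conj (h (conj λ))` has coefficients `conj h_k`). -/
def WRNonneg (ρ : ℝ) : Submodule ℝ (W ρ) where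
  carrier := {h | (∀ k < 0, h.1.coeff k = 0) ∧ ∀ k, conj (h.1.coeff k) = h.1.coeff k}
  zero_mem' := by simp
  add_mem' := by
    rintro f g ⟨hf, hf'⟩ ⟨hg, hg'⟩
    exact ⟨fun k hk => by simp [hf k hk, hg k hk], fun k => by simp [hf' k, hg' k]⟩
  smul_mem' := by
    rintro r f ⟨hf, hf'⟩
    exact ⟨fun k hk => by simp [hf k hk], fun k => by simp [hf' k]⟩

/-- The value `h(λ) = ∑ h_k λ^k`. -/
def loopEval {ρ : ℝ} (h : WRNonneg ρ) (lam : ℂ) : ℂ := ∑' k : ℤ, h.1.1.coeff k * lam ^ k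

/-- `h^*(λ) = conj (h (1 / conj λ))`. -/
def starLoop (h : ℂ → ℂ) (lam : ℂ) : ℂ := conj (h (1 / conj lam))

/-! ## Parameters -/

/-- The parameter vector `x = (ã, b̃, c̃, r, θ)`, with the product norm. -/
abbrev Param (ρ : ℝ) : Type := WRNonneg ρ × WRNonneg ρ × WRNonneg ρ × ℝ × ℝ

/-- The central value `(0, 0, 0, 1, π/2)`. -/
def central (ρ : ℝ) : Param ρ := (0, 0, 0, 1, Real.pi / 2)

variable {ρ : ℝ}

/-- `r`. -/
def Param.r (x : Param ρ) : ℝ := x.2.2.2.1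
/-- `θ`. -/
def Param.θ (x : Param ρ) : ℝ := x.2.2.2.2

/-- `a = (λ⁻¹ - λ)/2 + ã`. -/
def Param.a (x : Param ρ) (lam : ℂ) : ℂ := 1 / 2 * (lam⁻¹ - lam) + loopEval x.1 lam
/-- `b = -sin φ (λ⁻¹ + λ)/2 + b̃`. -/
def Param.b (φ : ℝ) (x : Param ρ) (lam : ℂ) : ℂ :=
  -(1 / 2) * (Real.sin φ : ℂ) * (lam⁻¹ + lam) + loopEval x.2.1 lam
/-- `c = -cos φ (λ⁻¹ + λ)/2 + c̃`. -/
def Param.c (φ : ℝ) (x : Param ρ) (lam : ℂ) : ℂ :=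
  -(1 / 2) * (Real.cos φ : ℂ) * (lam⁻¹ + lam) + loopEval x.2.2.1 lam

/-! ## The potential -/

/-- Complex `2 × 2` matrices. -/
abbrev M2 : Type := Matrix (Fin 2) (Fin 2) ℂ

/-- The punctures `p₁, p₂, p₃, p₄` (indexed from `0`). -/
def punct (φ : ℝ) : Fin 4 → ℂ :=
  ![exp (I * φ), -exp (-(I * φ)), -exp (I * φ), exp (-(I * φ))]

/-- The residues `A₁, A₂, A₃, A₄` (indexed from `0`) built from `a, b, c`. -/
def residue (a b c : ℂ) : Fin 4 → M2 :=
  ![!![I * a, b + I * c; b - I * c, -(I * a)],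
    !![-(I * a), -b + I * c; -b - I * c, I * a],
    !![I * a, -b - I * c; -b + I * c, -(I * a)],
    !![-(I * a), b - I * c; b + I * c, I * a]]

/-- The coefficient `E(λ, z)` of the potential
`η = E dz = r t ∑_k A_k(λ) dz / (z - p_k)`. -/
def potential (φ t : ℝ) (x : Param ρ) (lam z : ℂ) : M2 :=
  ((x.r * t : ℝ) : ℂ) •
    ∑ k, (1 / (z - punct φ k)) • residue (x.a lam) (x.b φ lam) (x.c φ lam) k

/-- `E dz` is a DPW potential in a chart domain `U`: the loop `λ ↦ λ E(λ, z)` on the unit circle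
extends to a function `B(λ, z)`, holomorphic for `λ` in (a neighbourhood of) the closed unit disc
and `z ∈ U`, with values in `𝔰𝔩(2, ℂ)`, and its value `B(0, z)`, the residue of `E` at `λ = 0`,
vanishes nowhere and is nilpotent. -/
def IsDPWChart (U : Set ℂ) (E : ℂ → ℂ → M2) : Prop :=
  ∃ B : ℂ → ℂ → M2,
    (∀ i j, AnalyticOnNhd ℂ (fun q : ℂ × ℂ => B q.1 q.2 i j) (Metric.closedBall 0 1 ×ˢ U)) ∧
    (∀ lam ∈ Metric.sphere (0 : ℂ) 1, ∀ z ∈ U, B lam z = lam • E lam z) ∧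
    (∀ lam ∈ Metric.closedBall (0 : ℂ) 1, ∀ z ∈ U, (B lam z).trace = 0) ∧
    (∀ z ∈ U, B 0 z ≠ 0 ∧ IsNilpotent (B 0 z))

/-- `E dz` is a DPW potential on `Σ_φ = ℂP¹ \ {p₁, …, p₄}`, in the charts `z` and `w = 1/z`
(where `E(z) dz = -w⁻² E(1/w) dw`). -/
def IsDPWPotential (φ : ℝ) (E : ℂ → ℂ → M2) : Prop :=
  IsDPWChart (range (punct φ))ᶜ E ∧
  ∃ E' : ℂ → ℂ → M2,
    IsDPWChart {w | w = 0 ∨ w⁻¹ ∉ range (punct φ)} E' ∧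
    ∀ lam ∈ Metric.sphere (0 : ℂ) 1, ∀ w : ℂ, w ≠ 0 → w⁻¹ ∉ range (punct φ) →
      E' lam w = (-(w ^ 2)⁻¹) • E lam w⁻¹

/-- `D = diag(i, -i)`. -/
def matD : M2 := !![I, 0; 0, -I]
/-- `C = (0, i; i, 0)`. -/
def matC : M2 := !![0, I; I, 0]

/-- The symmetries of `η = E dz` under `δ(z) = -z`, `τ(z) = 1/z`, `σ(z) = conj z`:
`δ^* η = D⁻¹ η D`, `τ^* η = C⁻¹ η C`, `σ^* conj η(·, conj λ) = η(·, λ)`. -/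
structure IsSymmetric (φ : ℝ) (E : ℂ → ℂ → M2) : Prop where
  delta : ∀ lam ∈ Metric.sphere (0 : ℂ) 1, ∀ z ∉ range (punct φ),
    (-1 : ℂ) • E lam (-z) = matD⁻¹ * E lam z * matD
  tau : ∀ lam ∈ Metric.sphere (0 : ℂ) 1, ∀ z ∉ range (punct φ), z ≠ 0 →
    (-(z ^ 2)⁻¹) • E lam (1 / z) = matC⁻¹ * E lam z * matC
  sigma : ∀ lam ∈ Metric.sphere (0 : ℂ) 1, ∀ z ∉ range (punct φ),
    (E (conj lam) (conj z)).map conj = E lam z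

/-! ## The principal solutions and the monodromy problem -/

/-- `Y` is the solution of `dΦ = Φ E dz`, `Φ(0) = Id`, along the segment `s ↦ s v`, `0 ≤ s ≤ 1`. -/
def IsFrameAlong (E : ℂ → M2) (v : ℂ) (Y : ℝ → M2) : Prop :=
  Y 0 = 1 ∧ ∀ s ∈ Icc (0 : ℝ) 1, ∀ i j,
    HasDerivWithinAt (fun s => Y s i j) ((v • (Y s * E (s * v))) i j) (Icc 0 1) s

open Classical in
/-- The principal solution `Φ(v)`: the value at the endpoint `v` of the solution of `dΦ = Φ E dz`,
`Φ(0) = Id` along the segment from `0` to `v`.  This solution exists and is unique when `E` is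
continuous on the segment (the value `0` otherwise is immaterial). -/
def principal (E : ℂ → M2) (v : ℂ) : M2 :=
  if h : ∃ Y, IsFrameAlong E v Y then h.choose 1 else 0

/-- `𝔭 = P₁₁ P₂₁ - P₁₂ P₂₂` for `P = Φ(1)`. -/
def pFun (φ t : ℝ) (x : Param ρ) (lam : ℂ) : ℂ :=
  let P := principal (potential φ t x lam) 1
  P 0 0 * P 1 0 - P 0 1 * P 1 1

/-- `𝔮 = i (Q₁₁ Q₂₁ + Q₁₂ Q₂₂)` for `Q = Φ(i)`. -/
def qFun (φ t : ℝ) (x : Param ρ) (lam : ℂ) : ℂ :=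
  let Q := principal (potential φ t x lam) I
  I * (Q 0 0 * Q 1 0 + Q 0 1 * Q 1 1)

/-- `\hat 𝔭(t) = (𝔭(t) - 𝔭(0)) / t` for `t ≠ 0`, and `𝔭'(0)` for `t = 0`. -/
def pHat (φ t : ℝ) (x : Param ρ) (lam : ℂ) : ℂ :=
  dslope (fun s : ℝ => pFun φ s x lam) 0 t

/-- `\hat 𝔮`, likewise. -/
def qHat (φ t : ℝ) (x : Param ρ) (lam : ℂ) : ℂ :=
  dslope (fun s : ℝ => qFun φ s x lam) 0 t

/-- `F = \hat 𝔭 - \hat 𝔭^*`. -/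
def calF (φ t : ℝ) (x : Param ρ) (lam : ℂ) : ℂ :=
  pHat φ t x lam - starLoop (pHat φ t x) lam

/-- `G = \hat 𝔮 - \hat 𝔮^*`. -/
def calG (φ t : ℝ) (x : Param ρ) (lam : ℂ) : ℂ :=
  qHat φ t x lam - starLoop (qHat φ t x) lam

/-- `K = det (r A₁)`. -/
def calK (φ : ℝ) (x : Param ρ) (lam : ℂ) : ℂ :=
  ((x.r : ℂ) • residue (x.a lam) (x.b φ lam) (x.c φ lam) 0).det

/-- `H₁ = \hat 𝔭(e^{iθ})`. -/
def calH₁ (φ t : ℝ) (x : Param ρ) : ℂ := pHat φ t x (exp (I * x.θ))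

/-- `H₂ = \hat 𝔮(e^{iθ})`. -/
def calH₂ (φ t : ℝ) (x : Param ρ) : ℂ := qHat φ t x (exp (I * x.θ))

/-- The reformulated monodromy problem for the potential with parameters `(φ, t, x)`; equalities
between loops are equalities on the unit circle. -/
structure SolvesMonodromyProblem (φ t : ℝ) (x : Param ρ) : Prop where
  F_eq : ∀ lam ∈ Metric.sphere (0 : ℂ) 1, calF φ t x lam = 0
  G_eq : ∀ lam ∈ Metric.sphere (0 : ℂ) 1, calG φ t x lam = 0
  K_eq : ∀ lam ∈ Metric.sphere (0 : ℂ) 1, calK φ x lam = -1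
  θ_mem : x.θ ∈ Ioo 0 Real.pi
  H₁_eq : calH₁ φ t x = 0
  H₂_eq : calH₂ φ t x = 0

end DPW

end

/-! The monodromy problem becomes one analytic equation in a Banach space, solved near `t = 0` by
the implicit function theorem.

Loops with real coefficients form a Banach algebra `RLoop ρ` under convolution, and evaluation at a
point of the unit circle is a ring homomorphism. Along the segment from 0 to 1 the coefficients of
the potential are real; along the segment from 0 to i, a constant diagonal gauge gives the same
system with φ replaced by π/2 - φ, a by -a, and b, c interchanged. Both equations are therefore
linear ODEs Y' = tYX over `RLoop ρ`, solved by (1 - tT)⁻¹1 with T a Volterra operator. Writing Y(1)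
= 1 + tZ removes the division by t, so the loops of 𝔭̂ and 𝔮̂ are analytic in (t, x), also across t
= 0, where they equal 2πrc and 2πrb (`hatLoop_zero`, `integral_segC`).

For real coefficients, F = 0 says that the coefficients of 𝔭̂ are symmetric under k ↦ -k, which is a
condition in the nonnegative loops (`skewPart`); the values on the circle are then real, so H₁ = 0
is one real equation, and likewise for G and H₂. The loop λ(K + 1) has no negative powers. Hence the
problem is `monodromyMap = 0` together with θ ∈ (0, π), where `monodromyMap` takes values in the
parameter space itself (`solvesMonodromyProblem_iff`).

Its partial derivative at the central value is `monodromyLin`. F and G determine c̃ and b̃ up to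
constants. The K equation then reduces to division by 1 - λ² with remainder of degree at most one,
possible uniquely because ρ > 1 makes the double left shift a contraction; this gives ã, r and one
linear relation between the two constants. The H equations give two more relations, and sin² φ +
cos² φ = 1 makes the resulting 3 × 3 system for θ and the constants invertible.

The symmetries hold for every parameter by the closed form `potential_eq`. The DPW property needs
only rt ≠ 0: at λ = 0 only the prescribed principal parts of a, b, c survive, and they give a
nonzero nilpotent matrix. -/

noncomputable section
namespace DPW

/-! ## The Banach algebra of loops with real Fourier coefficients -/

/-- The weight `ρ^|k|`. -/
def wt (ρ : ℝ) (k : ℤ) : ℝ := |ρ| ^ k.natAbs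

theorem wt_pos (ρ : ℝ) [hρ : Fact (1 < ρ)] (k : ℤ) : 0 < wt ρ k :=
  pow_pos (abs_pos.2 (by linarith [hρ.out])) _

theorem one_le_wt (ρ : ℝ) [hρ : Fact (1 < ρ)] (k : ℤ) : 1 ≤ wt ρ k :=
  one_le_pow₀ (hρ.out.le.trans (le_abs_self ρ))

theorem wt_add_le (ρ : ℝ) [hρ : Fact (1 < ρ)] (j k : ℤ) : wt ρ (j + k) ≤ wt ρ j * wt ρ k := by
  rw [wt, wt, wt, ← pow_add]
  exact pow_le_pow_right₀ (hρ.out.le.trans (le_abs_self ρ)) (Int.natAbs_add_le j k)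

theorem summable_pow_natAbs {q : ℝ} (h0 : 0 ≤ q) (h1 : q < 1) :
    Summable fun k : ℤ => q ^ k.natAbs := by
  rw [summable_int_iff_summable_nat_and_neg]
  simpa using summable_geometric_of_lt_one h0 h1

/-- Loops `∑ h_k λ^k` with `h_k ∈ ℝ` and `∑ |h_k| ρ^|k| < ∞`, stored as the sequence
`h_k ρ^|k|`. -/
def RLoop (_ρ : ℝ) : Type := lp (fun _ : ℤ => ℝ) 1

namespace RLoop

variable {ρ : ℝ}

instance : NormedAddCommGroup (RLoop ρ) := inferInstanceAs (NormedAddCommGroup (lp _ 1))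
instance : NormedSpace ℝ (RLoop ρ) := inferInstanceAs (NormedSpace ℝ (lp (fun _ : ℤ => ℝ) 1))
instance : CompleteSpace (RLoop ρ) := inferInstanceAs (CompleteSpace (lp (fun _ : ℤ => ℝ) 1))

/-- The `k`-th Fourier coefficient. -/
def coeff (f : RLoop ρ) (k : ℤ) : ℝ := (show lp (fun _ : ℤ => ℝ) 1 from f) k / wt ρ k

@[simp] theorem coeff_zero (k : ℤ) : (0 : RLoop ρ).coeff k = 0 := zero_div _

@[simp] theorem coeff_add (f g : RLoop ρ) (k : ℤ) : (f + g).coeff k = f.coeff k + g.coeff k :=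
  add_div _ _ _

@[simp] theorem coeff_sub (f g : RLoop ρ) (k : ℤ) : (f - g).coeff k = f.coeff k - g.coeff k :=
  sub_div _ _ _

@[simp] theorem coeff_neg (f : RLoop ρ) (k : ℤ) : (-f).coeff k = -f.coeff k :=
  neg_div _ _

@[simp] theorem coeff_smul (r : ℝ) (f : RLoop ρ) (k : ℤ) : (r • f).coeff k = r * f.coeff k :=
  mul_div_assoc _ _ _

variable [hρ : Fact (1 < ρ)]

theorem coeff_mul_wt (f : RLoop ρ) (k : ℤ) :
    f.coeff k * wt ρ k = (show lp (fun _ : ℤ => ℝ) 1 from f) k :=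
  div_mul_cancel₀ _ (wt_pos ρ k).ne'

@[ext] theorem ext {f g : RLoop ρ} (h : ∀ k, f.coeff k = g.coeff k) : f = g := by
  refine lp.ext (funext fun k => ?_)
  exact (coeff_mul_wt f k).symm.trans ((congrArg (· * wt ρ k) (h k)).trans (coeff_mul_wt g k))

theorem summable_coeff (f : RLoop ρ) : Summable fun k => |f.coeff k| * wt ρ k := by
  have h := (memℓp_gen_iff (p := 1) (by simp)).1 (lp.memℓp (show lp (fun _ : ℤ => ℝ) 1 from f))
  refine h.congr fun k => ?_
  rw [← coeff_mul_wt]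
  simp [abs_of_pos (wt_pos ρ k)]

theorem norm_eq (f : RLoop ρ) : ‖f‖ = ∑' k, |f.coeff k| * wt ρ k := by
  refine (lp.norm_eq_tsum_rpow (p := 1) (by simp) (show lp (fun _ : ℤ => ℝ) 1 from f)).trans ?_
  simp only [ENNReal.toReal_one, Real.rpow_one, div_one]
  refine tsum_congr fun k => ?_
  rw [← coeff_mul_wt]
  simp [abs_of_pos (wt_pos ρ k)]

/-- The loop with given coefficients. -/
def mk (c : ℤ → ℝ) (hc : Summable fun k => |c k| * wt ρ k) : RLoop ρ :=
  (⟨fun k => c k * wt ρ k, memℓp_gen (by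
    refine hc.congr fun k => ?_
    simp [abs_of_pos (wt_pos ρ k)])⟩ : lp (fun _ : ℤ => ℝ) 1)

@[simp] theorem coeff_mk (c : ℤ → ℝ) (hc : Summable fun k => |c k| * wt ρ k) (k : ℤ) :
    (mk c hc).coeff k = c k :=
  mul_div_cancel_right₀ _ (wt_pos ρ k).ne'

theorem abs_coeff_mul_wt_le (f : RLoop ρ) (k : ℤ) : |f.coeff k| * wt ρ k ≤ ‖f‖ := by
  rw [norm_eq]
  exact f.summable_coeff.le_tsum k fun j _ => mul_nonneg (abs_nonneg _) (wt_pos ρ j).le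

theorem abs_coeff_le (f : RLoop ρ) (k : ℤ) : |f.coeff k| ≤ (wt ρ k)⁻¹ * ‖f‖ := by
  rw [inv_mul_eq_div, le_div_iff₀ (wt_pos ρ k)]
  exact f.abs_coeff_mul_wt_le k

/-- The `k`-th coefficient as a complex valued continuous linear map. -/
def coeffC (k : ℤ) : RLoop ρ →L[ℝ] ℂ :=
  LinearMap.mkContinuous
    { toFun := fun f => (f.coeff k : ℂ)
      map_add' := fun f g => by simp
      map_smul' := fun r f => by simp } (wt ρ k)⁻¹
    fun f => by simpa using f.abs_coeff_le k

@[simp] theorem coeffC_apply (k : ℤ) (f : RLoop ρ) : coeffC k f = (f.coeff k : ℂ) := rfl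

theorem norm_coeffC_le (k : ℤ) : ‖(coeffC k : RLoop ρ →L[ℝ] ℂ)‖ ≤ (wt ρ k)⁻¹ :=
  LinearMap.mkContinuous_norm_le _ (inv_nonneg.2 (wt_pos ρ k).le) _

/-- Evaluation at `z`. -/
def ev (z : ℂ) : RLoop ρ →L[ℝ] ℂ := ∑' k : ℤ, z ^ k • coeffC k

theorem norm_zpow_le {z : ℂ} {R : ℝ} (h1 : R⁻¹ ≤ ‖z‖) (h2 : ‖z‖ ≤ R) (hR : 0 < R) (k : ℤ) :
    ‖z ^ k‖ ≤ R ^ k.natAbs := by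
  have hz : 0 < ‖z‖ := (inv_pos.2 hR).trans_le h1
  rw [norm_zpow]
  obtain ⟨n, rfl | rfl⟩ := k.eq_nat_or_neg
  · simpa using pow_le_pow_left₀ hz.le h2 n
  · have : ‖z‖⁻¹ ≤ R := inv_le_of_inv_le₀ hR h1
    simpa [← inv_pow] using pow_le_pow_left₀ (inv_nonneg.2 hz.le) this n

/-- The growth R^|k| of the monomial competes with the norm ρ^(-|k|) of the coefficient functional;
for R < ρ the bound is a convergent geometric majorant. -/
theorem norm_zpow_smul_coeffC_le {z : ℂ} {R : ℝ} (h1 : R⁻¹ ≤ ‖z‖) (h2 : ‖z‖ ≤ R) (hR : 0 < R)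
    (k : ℤ) : ‖z ^ k • (coeffC k : RLoop ρ →L[ℝ] ℂ)‖ ≤ (R / |ρ|) ^ k.natAbs := by
  rw [norm_smul, div_pow, div_eq_mul_inv]
  exact mul_le_mul (norm_zpow_le h1 h2 hR k) (norm_coeffC_le k) (norm_nonneg _) (by positivity)

theorem abs_rho : |ρ| = ρ := abs_of_pos (by linarith [hρ.out])

theorem summable_ev {z : ℂ} (hz : ‖z‖ = 1) :
    Summable fun k : ℤ => z ^ k • (coeffC k : RLoop ρ →L[ℝ] ℂ) := by
  refine Summable.of_norm_bounded (summable_pow_natAbs (q := 1 / |ρ|) (by positivity) ?_)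
    fun k => norm_zpow_smul_coeffC_le (by simp [hz]) hz.le one_pos k
  rw [abs_rho, div_lt_one] <;> linarith [hρ.out]

theorem hasSum_ev {z : ℂ} (hz : ‖z‖ = 1) (f : RLoop ρ) :
    HasSum (fun k : ℤ => (f.coeff k : ℂ) * z ^ k) (ev z f) := by
  have h := (ContinuousLinearMap.apply ℝ ℂ f).hasSum (summable_ev hz).hasSum
  refine h.congr_fun fun k => ?_
  simp [mul_comm]

theorem summable_norm_ev {z : ℂ} (hz : ‖z‖ = 1) (f : RLoop ρ) :
    Summable fun k : ℤ => ‖(f.coeff k : ℂ) * z ^ k‖ := by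
  refine Summable.of_nonneg_of_le (fun k => norm_nonneg _) (fun k => ?_) f.summable_coeff
  rw [norm_mul, norm_zpow, hz, one_zpow, Complex.norm_real, Real.norm_eq_abs]
  exact mul_le_mul_of_nonneg_left (one_le_wt ρ k) (abs_nonneg _)

/-- Evaluation is analytic in the point of the unit circle, as a map into the dual space. -/
theorem analyticAt_ev {z : ℂ} (hz : ‖z‖ = 1) :
    AnalyticAt ℂ (fun w : ℂ => (ev w : RLoop ρ →L[ℝ] ℂ)) z := by
  -- With 1 < R < ρ, the operator series converges uniformly on the annulus R⁻¹ < |w| < R around the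
  -- circle, so its sum is holomorphic there.
  obtain ⟨R, hR1, hR2⟩ := exists_between hρ.out
  have hR0 : 0 < R := one_pos.trans hR1
  let U : Set ℂ := {w | R⁻¹ < ‖w‖ ∧ ‖w‖ < R}
  have hU : IsOpen U :=
    (isOpen_lt continuous_const continuous_norm).inter (isOpen_lt continuous_norm continuous_const)
  have hzU : z ∈ U := ⟨by rw [hz]; exact inv_lt_one_of_one_lt₀ hR1, by rw [hz]; exact hR1⟩
  have hd : DifferentiableOn ℂ (fun w : ℂ => (ev w : RLoop ρ →L[ℝ] ℂ)) U := by
    refine differentiableOn_tsum_of_summable_norm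
      (summable_pow_natAbs (q := R / |ρ|) (by positivity) ?_) (fun k w hw => ?_) hU
      (fun k w hw => norm_zpow_smul_coeffC_le hw.1.le hw.2.le hR0 k)
    · rw [abs_rho, div_lt_one] <;> linarith [hρ.out]
    · have hw0 : w ≠ 0 := norm_pos_iff.1 ((inv_pos.2 hR0).trans hw.1)
      exact ((differentiableAt_zpow.2 (Or.inl hw0)).smul_const _).differentiableWithinAt
  exact hd.analyticAt (hU.mem_nhds hzU)

/-! ### Uniqueness of Fourier coefficients -/

/-- The series converges absolutely in the continuous functions on the circle; its sum is 0, and the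
L² pairing with the n-th character isolates `c n`. -/
theorem _root_.DPW.coeff_eq_zero_of_hasSum {c : ℤ → ℂ} (hc : Summable fun k => ‖c k‖)
    (h : ∀ z : ℂ, ‖z‖ = 1 → HasSum (fun k => c k * z ^ k) 0) (n : ℤ) : c n = 0 := by
  have : Fact ((0 : ℝ) < 2 * Real.pi) := ⟨Real.two_pi_pos⟩
  have hs : Summable fun k => c k • (fourier k : C(AddCircle (2 * Real.pi), ℂ)) := by
    refine Summable.of_norm (hc.congr fun k => ?_)
    rw [norm_smul, fourier_norm, mul_one]
  have h0 : HasSum (fun k => c k • (fourier k : C(AddCircle (2 * Real.pi), ℂ))) 0 := by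
    have he : ∑' k, c k • (fourier k : C(AddCircle (2 * Real.pi), ℂ)) = 0 := by
      ext x
      have h1 := (ContinuousMap.evalCLM ℂ x).hasSum hs.hasSum
      have h2 := h (AddCircle.toCircle x : ℂ) (Circle.norm_coe _)
      refine h1.unique ?_
      refine h2.congr_fun fun k => ?_
      simp [fourier_apply, AddCircle.toCircle_zsmul]
    exact he ▸ hs.hasSum
  have h1 := ((innerSL ℂ (fourierLp (T := 2 * Real.pi) 2 n)) ∘L
    (ContinuousMap.toLp 2 AddCircle.haarAddCircle ℂ)).hasSum h0
  have h2 : HasSum (fun k => if k = n then c k else 0) 0 := by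
    rw [map_zero] at h1
    refine h1.congr_fun fun k => ?_
    have h3 := orthonormal_iff_ite.1 (orthonormal_fourier (T := 2 * Real.pi)) n k
    rw [fourierLp] at h3
    simp [fourierLp, h3, eq_comm]
  refine (hasSum_ite_eq n (c n)).unique (h2.congr_fun fun k => ?_)
  by_cases hk : k = n <;> simp [hk]

/-- This reduces identities between loops to identities of complex numbers; all ring axioms for
convolution are obtained this way. -/
theorem ext_of_ev {f g : RLoop ρ} (h : ∀ z : ℂ, ‖z‖ = 1 → ev z f = ev z g) : f = g := by
  refine ext fun k => ?_
  have h1 := DPW.coeff_eq_zero_of_hasSum (c := fun k => ((f - g).coeff k : ℂ))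
    (by simpa using summable_norm_ev (z := 1) norm_one (f - g)) (fun z hz => by
      simpa [h z hz] using hasSum_ev hz (f - g)) k
  have h2 : (f - g).coeff k = 0 := by exact_mod_cast h1
  exact sub_eq_zero.1 (by simpa using h2)

/-! ### The product -/

/-- The shear `(k, j) ↦ (j, k - j)`. -/
def shear : ℤ × ℤ ≃ ℤ × ℤ where
  toFun q := (q.2, q.1 - q.2)
  invFun q := (q.1 + q.2, q.1)
  left_inv q := by simp
  right_inv q := by simp

/-- The family of all products of weighted coefficients, sorted by total degree k; its row sums
dominate the weighted coefficients of the convolution. -/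
theorem summable_shear (f g : RLoop ρ) : Summable fun q : ℤ × ℤ =>
    (|f.coeff q.2| * wt ρ q.2) * (|g.coeff (q.1 - q.2)| * wt ρ (q.1 - q.2)) :=
  shear.summable_iff.2 (f.summable_coeff.mul_of_nonneg g.summable_coeff
    (fun k => mul_nonneg (abs_nonneg _) (wt_pos ρ k).le)
    (fun k => mul_nonneg (abs_nonneg _) (wt_pos ρ k).le))

theorem abs_mul_coeff_le (f g : RLoop ρ) (k j : ℤ) :
    |f.coeff j * g.coeff (k - j)| * wt ρ k ≤
      (|f.coeff j| * wt ρ j) * (|g.coeff (k - j)| * wt ρ (k - j)) := by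
  have h := wt_add_le ρ j (k - j)
  rw [add_sub_cancel] at h
  rw [abs_mul, mul_mul_mul_comm]
  exact mul_le_mul_of_nonneg_left h (by positivity)

theorem summable_abs_conv (f g : RLoop ρ) (k : ℤ) :
    Summable fun j => |f.coeff j * g.coeff (k - j)| := by
  refine Summable.of_nonneg_of_le (fun j => abs_nonneg _) (fun j => ?_)
    ((summable_shear f g).prod_factor k)
  exact (le_mul_of_one_le_right (abs_nonneg _) (one_le_wt ρ k)).trans (abs_mul_coeff_le f g k j)

theorem abs_conv_mul_wt_le (f g : RLoop ρ) (k : ℤ) :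
    |∑' j, f.coeff j * g.coeff (k - j)| * wt ρ k ≤
      ∑' j, (|f.coeff j| * wt ρ j) * (|g.coeff (k - j)| * wt ρ (k - j)) := by
  have h1 : |∑' j, f.coeff j * g.coeff (k - j)| ≤ ∑' j, |f.coeff j * g.coeff (k - j)| := by
    simpa using norm_tsum_le_tsum_norm (f := fun j => f.coeff j * g.coeff (k - j))
      (by simpa [abs_mul] using summable_abs_conv f g k)
  calc _ ≤ (∑' j, |f.coeff j * g.coeff (k - j)|) * wt ρ k :=
        mul_le_mul_of_nonneg_right h1 (wt_pos ρ k).le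
    _ = ∑' j, |f.coeff j * g.coeff (k - j)| * wt ρ k := tsum_mul_right.symm
    _ ≤ _ := Summable.tsum_le_tsum (fun j => abs_mul_coeff_le f g k j)
        ((summable_abs_conv f g k).mul_right _) ((summable_shear f g).prod_factor k)

instance : Mul (RLoop ρ) :=
  ⟨fun f g => mk (fun k => ∑' j, f.coeff j * g.coeff (k - j))
    (Summable.of_nonneg_of_le (fun k => mul_nonneg (abs_nonneg _) (wt_pos ρ k).le)
      (fun k => abs_conv_mul_wt_le f g k) (summable_shear f g).prod)⟩

theorem coeff_mul (f g : RLoop ρ) (k : ℤ) :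
    (f * g).coeff k = ∑' j, f.coeff j * g.coeff (k - j) :=
  coeff_mk _ _ _

theorem norm_mul_le' (f g : RLoop ρ) : ‖f * g‖ ≤ ‖f‖ * ‖g‖ := by
  have h0 := f.summable_coeff.tsum_mul_tsum g.summable_coeff
    (f.summable_coeff.mul_of_nonneg g.summable_coeff
      (fun k => mul_nonneg (abs_nonneg _) (wt_pos ρ k).le)
      (fun k => mul_nonneg (abs_nonneg _) (wt_pos ρ k).le))
  rw [norm_eq f, norm_eq g, h0, ← shear.tsum_eq]
  refine le_of_le_of_eq ?_ (summable_shear f g).tsum_prod.symm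
  rw [norm_eq]
  refine Summable.tsum_le_tsum (fun k => ?_) (f * g).summable_coeff (summable_shear f g).prod
  rw [coeff_mul]
  exact abs_conv_mul_wt_le f g k

/-- Cauchy product of two absolutely convergent Laurent series, regrouped by total degree with
`shear`. -/
theorem ev_mul {z : ℂ} (hz : ‖z‖ = 1) (f g : RLoop ρ) : ev z (f * g) = ev z f * ev z g := by
  have hz0 : z ≠ 0 := norm_pos_iff.1 (hz ▸ one_pos)
  have hs := summable_mul_of_summable_norm (summable_norm_ev hz f) (summable_norm_ev hz g)
  rw [← (hasSum_ev hz f).tsum_eq, ← (hasSum_ev hz g).tsum_eq,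
    tsum_mul_tsum_of_summable_norm (summable_norm_ev hz f) (summable_norm_ev hz g),
    ← shear.tsum_eq]
  refine Eq.trans ?_ (shear.summable_iff.2 hs).tsum_prod.symm
  rw [← (hasSum_ev hz (f * g)).tsum_eq]
  refine tsum_congr fun k => ?_
  rw [coeff_mul, ofReal_tsum, ← tsum_mul_right]
  refine tsum_congr fun j => ?_
  have : z ^ k = z ^ j * z ^ (k - j) := by rw [← zpow_add₀ hz0, add_sub_cancel]
  simp only [shear, Equiv.coe_fn_mk, ofReal_mul, this, Function.comp_apply]
  ring

/-! ### Monomials -/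

/-- The monomial `λ^n`. -/
def X (n : ℤ) : RLoop ρ :=
  mk (Pi.single n 1) (summable_of_ne_finset_zero (s := {n}) fun k hk => by
    simp [Pi.single_eq_of_ne (Finset.notMem_singleton.1 hk)])

@[simp] theorem coeff_X (n k : ℤ) : (X n : RLoop ρ).coeff k = (Pi.single n 1 : ℤ → ℝ) k :=
  coeff_mk _ _ _

@[simp] theorem ev_X {z : ℂ} (hz : ‖z‖ = 1) (n : ℤ) : ev z (X n : RLoop ρ) = z ^ n := by
  refine (hasSum_ev hz _).unique ?_
  convert hasSum_ite_eq n (z ^ n) using 2 with k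
  by_cases hk : k = n
  · subst hk; simp
  · simp [hk]

instance : One (RLoop ρ) := ⟨X 0⟩

theorem one_def : (1 : RLoop ρ) = X 0 := rfl

theorem ev_one {z : ℂ} (hz : ‖z‖ = 1) : ev z (1 : RLoop ρ) = 1 := by
  rw [one_def, ev_X hz, zpow_zero]

instance : CommRing (RLoop ρ) :=
  { (inferInstance : AddCommGroup (RLoop ρ)) with
    mul := (· * ·)
    one := 1
    left_distrib := fun f g h => ext_of_ev fun z hz => by simp only [map_add, ev_mul hz, mul_add]
    right_distrib := fun f g h => ext_of_ev fun z hz => by simp only [map_add, ev_mul hz, add_mul]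
    zero_mul := fun f => ext_of_ev fun z hz => by simp only [map_zero, ev_mul hz, zero_mul]
    mul_zero := fun f => ext_of_ev fun z hz => by simp only [map_zero, ev_mul hz, mul_zero]
    mul_assoc := fun f g h => ext_of_ev fun z hz => by simp only [ev_mul hz, mul_assoc]
    one_mul := fun f => ext_of_ev fun z hz => by simp only [ev_mul hz, ev_one hz, one_mul]
    mul_one := fun f => ext_of_ev fun z hz => by simp only [ev_mul hz, ev_one hz, mul_one]
    mul_comm := fun f g => ext_of_ev fun z hz => by simp only [ev_mul hz, mul_comm] }

instance : NormedCommRing (RLoop ρ) :=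
  { (inferInstance : NormedAddCommGroup (RLoop ρ)), (inferInstance : CommRing (RLoop ρ)) with
    norm_mul_le := norm_mul_le' }

instance : NormedAlgebra ℝ (RLoop ρ) :=
  { Algebra.ofModule (R := ℝ) (A := RLoop ρ)
      (fun r f g => ext_of_ev fun z hz => by simp only [map_smul, ev_mul hz, smul_mul_assoc])
      (fun r f g => ext_of_ev fun z hz => by simp only [map_smul, ev_mul hz, mul_smul_comm]) with
    norm_smul_le := norm_smul_le }

theorem X_mul_X (m n : ℤ) : (X m * X n : RLoop ρ) = X (m + n) :=
  ext_of_ev fun z hz => by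
    rw [ev_mul hz, ev_X hz, ev_X hz, ev_X hz, zpow_add₀ (norm_pos_iff.1 (hz ▸ one_pos))]

theorem coeff_X_mul (n : ℤ) (f : RLoop ρ) (k : ℤ) : (X n * f).coeff k = f.coeff (k - n) := by
  rw [coeff_mul, tsum_eq_single n fun j hj => by simp [hj]]
  simp

/-! ### Reality of values -/

theorem conj_ev {z : ℂ} (hz : ‖z‖ = 1) (f : RLoop ρ) :
    HasSum (fun k : ℤ => (f.coeff (-k) : ℂ) * z ^ k) (conj (ev z f)) := by
  have h := (Equiv.neg ℤ).hasSum_iff.2 ((hasSum_conj'.2 (hasSum_ev hz f)))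
  refine h.congr_fun fun k => ?_
  have hc : conj z = z⁻¹ := (Complex.inv_eq_conj hz).symm
  simp [hc]

/-- On the circle conj z = z⁻¹, so with real coefficients conjugating the value reverses the
coefficient sequence; uniqueness of Fourier coefficients does the rest. -/
theorem ev_real_iff (f : RLoop ρ) :
    (∀ z : ℂ, ‖z‖ = 1 → ev z f = conj (ev z f)) ↔ ∀ k, f.coeff k = f.coeff (-k) := by
  constructor
  · intro h k
    have h1 := DPW.coeff_eq_zero_of_hasSum (c := fun k => (f.coeff k : ℂ) - (f.coeff (-k) : ℂ))
      (Summable.of_nonneg_of_le (fun k => norm_nonneg _) (fun k => norm_sub_le _ _)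
        ((by simpa using summable_norm_ev (z := 1) norm_one f : Summable fun k =>
            ‖(f.coeff k : ℂ)‖).add
          ((Equiv.neg ℤ).summable_iff.2 (by simpa using summable_norm_ev (z := 1) norm_one f :
            Summable fun k => ‖(f.coeff k : ℂ)‖)))) (fun z hz => by
        have h2 := (hasSum_ev hz f).sub (conj_ev hz f)
        rw [← h z hz, sub_self] at h2
        exact h2.congr_fun fun k => sub_mul _ _ _) k
    exact_mod_cast sub_eq_zero.1 h1
  · intro h z hz
    refine (hasSum_ev hz f).unique ((conj_ev hz f).congr_fun fun k => ?_)
    rw [h k]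

end RLoop
end DPW

namespace DPW

set_option linter.unusedSectionVars false

open scoped unitInterval ContDiff

/-! ## Linear ordinary differential equations in Banach algebras -/

section Neumann

variable {E P : Type*} [NormedAddCommGroup E] [NormedSpace ℝ E] [NormedAddCommGroup P]
  [NormedSpace ℝ P]

/-- Invertibility of `1 - t T`. -/
def NeumannInv (t : ℝ) (T : E →L[ℝ] E) : Prop := IsUnit (1 - t • T)

/-- The solution `(1 - t T)⁻¹ e` of the equation `y = e + t T y`. -/
def neumann (t : ℝ) (T : E →L[ℝ] E) (e : E) : E := Ring.inverse (1 - t • T) e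

theorem neumannInv_zero (T : E →L[ℝ] E) : NeumannInv 0 T := by
  simp [NeumannInv]

theorem neumann_zero (T : E →L[ℝ] E) (e : E) : neumann 0 T e = e := by
  simp [neumann]

theorem neumann_eq {t : ℝ} {T : E →L[ℝ] E} (h : NeumannInv t T) (e : E) :
    neumann t T e = e + t • T (neumann t T e) := by
  have h1 : (1 - t • T) (neumann t T e) = e :=
    congrArg (fun S : E →L[ℝ] E => S e) (Ring.mul_inverse_cancel _ h)
  exact sub_eq_iff_eq_add.1 h1

theorem isOpen_neumannInv [CompleteSpace E] :
    IsOpen {q : ℝ × (E →L[ℝ] E) | NeumannInv q.1 q.2} := by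
  have h : Continuous fun q : ℝ × (E →L[ℝ] E) => 1 - q.1 • q.2 := by fun_prop
  exact Units.isOpen.preimage h

/-- Inversion in the Banach algebra of bounded operators is analytic at every unit. -/
theorem contDiffAt_neumann [CompleteSpace E] {t : ℝ} {T : E →L[ℝ] E} (h : NeumannInv t T)
    (e : E) : ContDiffAt ℝ ω (fun q : ℝ × (E →L[ℝ] E) => neumann q.1 q.2 e) (t, T) := by
  obtain ⟨u, hu⟩ := h
  have h1 : ContDiffAt ℝ ω (fun q : ℝ × (E →L[ℝ] E) => 1 - q.1 • q.2) (t, T) := by fun_prop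
  have h2 := contDiffAt_ringInverse ℝ (n := ω) u
  rw [hu] at h2
  exact (h2.comp (t, T) h1).clm_apply contDiffAt_const

end Neumann

section LinearODE

variable {M : Type*} [NormedRing M] [NormedAlgebra ℝ M]

/-- The Banach algebra of continuous functions on the unit interval. -/
def Paths (M : Type*) [TopologicalSpace M] : Type _ := C(I, M)

instance : NormedRing (Paths M) := inferInstanceAs (NormedRing C(I, M))
instance : NormedAlgebra ℝ (Paths M) := inferInstanceAs (NormedAlgebra ℝ C(I, M))
instance [CompleteSpace M] : CompleteSpace (Paths M) := inferInstanceAs (CompleteSpace C(I, M))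

namespace Paths

/-- The underlying continuous map. -/
def toMap (f : Paths M) : C(I, M) := f

instance : CoeFun (Paths M) fun _ => I → M := ⟨fun f => f.toMap⟩

theorem add_apply (f g : Paths M) (s : I) : (f + g) s = f s + g s := rfl
theorem mul_apply (f g : Paths M) (s : I) : (f * g) s = f s * g s := rfl
theorem smul_apply (r : ℝ) (f : Paths M) (s : I) : (r • f) s = r • f s := rfl
theorem one_apply (s : I) : (1 : Paths M) s = 1 := rfl

theorem continuous_coe (f : Paths M) : Continuous f := f.toMap.continuous

theorem norm_coe_le (f : Paths M) (s : I) : ‖f s‖ ≤ ‖f‖ := f.toMap.norm_coe_le_norm s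

theorem norm_le (f : Paths M) {C : ℝ} (hC : 0 ≤ C) (h : ∀ s, ‖f s‖ ≤ C) : ‖f‖ ≤ C :=
  (ContinuousMap.norm_le f.toMap hC).2 h

/-- Evaluation at a point. -/
def eval (s : I) : Paths M →L[ℝ] M :=
  LinearMap.mkContinuous
    { toFun := fun f => f s
      map_add' := fun f g => add_apply f g s
      map_smul' := fun r f => smul_apply r f s } 1
    fun f => by simpa using f.norm_coe_le s

end Paths

/-- The primitive vanishing at `0` of a function on the unit interval, extended by constants. -/
def primitive (f : Paths M) (s : ℝ) : M := ∫ u in (0 : ℝ)..s, IccExtend zero_le_one f u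

theorem primitive_zero (f : Paths M) : primitive f 0 = 0 := intervalIntegral.integral_same

theorem intervalIntegrable_IccExtend (f : Paths M) (s : ℝ) :
    IntervalIntegrable (IccExtend zero_le_one f) MeasureTheory.volume 0 s :=
  (f.continuous_coe.Icc_extend' (h := zero_le_one)).intervalIntegrable 0 s

theorem primitive_add (f g : Paths M) (s : ℝ) :
    primitive (f + g) s = primitive f s + primitive g s :=
  intervalIntegral.integral_add (intervalIntegrable_IccExtend f s)
    (intervalIntegrable_IccExtend g s)

theorem primitive_smul (r : ℝ) (f : Paths M) (s : ℝ) :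
    primitive (r • f) s = r • primitive f s :=
  intervalIntegral.integral_smul r _

theorem norm_primitive_le (f : Paths M) (s : I) : ‖primitive f s‖ ≤ ‖f‖ := by
  have h := intervalIntegral.norm_integral_le_of_norm_le_const (a := 0) (b := (s : ℝ))
    (f := IccExtend zero_le_one f) (C := ‖f‖) fun u _ => f.norm_coe_le _
  refine h.trans (mul_le_of_le_one_right (norm_nonneg _) ?_)
  rw [sub_zero, abs_of_nonneg s.2.1]
  exact s.2.2

variable [CompleteSpace M]

theorem hasDerivAt_primitive (f : Paths M) (s : ℝ) :
    HasDerivAt (primitive f) (IccExtend zero_le_one f s) s :=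
  (f.continuous_coe.Icc_extend' (h := zero_le_one)).integral_hasStrictDerivAt 0 s |>.hasDerivAt

/-- The integration operator `f ↦ ∫₀ f` on `C([0, 1], M)`. -/
def integOp : Paths M →L[ℝ] Paths M :=
  LinearMap.mkContinuous
    { toFun := fun f => (⟨fun s => primitive f s,
        (continuous_iff_continuousAt.2 fun s => (hasDerivAt_primitive f s).continuousAt).comp
          continuous_subtype_val⟩ : C(I, M))
      map_add' := fun f g => ContinuousMap.ext fun s : I => primitive_add f g s
      map_smul' := fun r f => ContinuousMap.ext fun s : I => primitive_smul r f s } 1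
    fun f => by
      rw [one_mul]
      exact Paths.norm_le _ (norm_nonneg f) (norm_primitive_le f)

/-- The Volterra operator `Y ↦ ∫₀ Y X`, as a linear function of `X`. -/
def volterra : Paths M →L[ℝ] Paths M →L[ℝ] Paths M :=
  (ContinuousLinearMap.compL ℝ (Paths M) (Paths M) (Paths M) integOp) ∘L
    (ContinuousLinearMap.mul ℝ (Paths M)).flip

/-- The solution of `Y' = t Y X`, `Y(0) = 1`, as a Neumann series. -/
def odeSol (t : ℝ) (X : Paths M) : Paths M := neumann t (volterra X) 1

/-- The quotient `(Y(1) - 1) / t` for the solution of `Y' = t Y X`, `Y(0) = 1`. -/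
def odeQuot (t : ℝ) (X : Paths M) : M := primitive (odeSol t X * X) 1

theorem odeSol_eq {t : ℝ} {X : Paths M} (h : NeumannInv t (volterra X)) (s : I) :
    odeSol t X s = 1 + t • primitive (odeSol t X * X) s :=
  congrArg (fun f : Paths M => f s) (neumann_eq h 1)

/-- The solution of `Y' = t Y X`, `Y(0) = 1`, as a function on the real line. -/
def odeFrame (t : ℝ) (X : Paths M) (s : ℝ) : M := 1 + t • primitive (odeSol t X * X) s

theorem odeFrame_zero (t : ℝ) (X : Paths M) : odeFrame t X 0 = 1 := by
  rw [odeFrame, primitive_zero, smul_zero, add_zero]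

theorem odeFrame_one (t : ℝ) (X : Paths M) : odeFrame t X 1 = 1 + t • odeQuot t X := rfl

theorem hasDerivAt_odeFrame {t : ℝ} {X : Paths M} (h : NeumannInv t (volterra X)) (s : I) :
    HasDerivAt (odeFrame t X) (t • (odeFrame t X s * X s)) s := by
  have h1 := ((hasDerivAt_primitive (odeSol t X * X) s).const_smul t).const_add 1
  rw [IccExtend_val, Paths.mul_apply, odeSol_eq h] at h1
  exact h1

/-- The quotient is the integral of Y X, with no division by t, so analyticity holds across t = 0 as
well. -/
theorem contDiffAt_odeQuot {t : ℝ} {X : Paths M} (h : NeumannInv t (volterra X)) :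
    ContDiffAt ℝ ω (fun q : ℝ × Paths M => odeQuot q.1 q.2) (t, X) := by
  have h3 : ContDiffAt ℝ ω (fun q : ℝ × Paths M => odeSol q.1 q.2) (t, X) :=
    (contDiffAt_neumann h 1).comp (t, X)
      (contDiffAt_fst.prodMk (volterra.contDiff.contDiffAt.comp _ contDiffAt_snd))
  have h4 : ContDiffAt ℝ ω (fun q : ℝ × Paths M => integOp (odeSol q.1 q.2 * q.2)) (t, X) :=
    integOp.contDiff.contDiffAt.comp _ (h3.mul contDiffAt_snd)
  exact ((Paths.eval (1 : I)).contDiff.contDiffAt).comp _ h4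

theorem odeQuot_zero (X : Paths M) : odeQuot 0 X = primitive X 1 := by
  rw [odeQuot, odeSol, neumann_zero, one_mul]

end LinearODE

/-! ## The matrix equation -/

section MatrixODE

variable {A : Type*} [NormedCommRing A] [NormedAlgebra ℝ A]

/-- The Banach algebra of `2 × 2` matrices, with the topology of the operator norm. -/
def Mat2 (A : Type*) : Type _ := Matrix (Fin 2) (Fin 2) A

namespace Mat2

section

attribute [local instance] Matrix.linftyOpNormedRing Matrix.linftyOpNormedAlgebra

instance : NormedRing (Mat2 A) := inferInstanceAs (NormedRing (Matrix (Fin 2) (Fin 2) A))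
instance : NormedAlgebra ℝ (Mat2 A) :=
  inferInstanceAs (NormedAlgebra ℝ (Matrix (Fin 2) (Fin 2) A))

end

instance [CompleteSpace A] : CompleteSpace (Mat2 A) :=
  inferInstanceAs (CompleteSpace (Fin 2 → Fin 2 → A))


/-- A matrix entry as a continuous linear map. -/
def entry (i j : Fin 2) : Mat2 A →L[ℝ] A where
  toFun m := m i j
  map_add' _ _ := rfl
  map_smul' _ _ := rfl
  cont := (continuous_apply j).comp (continuous_apply (A := fun _ : Fin 2 => Fin 2 → A) i)

theorem entry_apply (i j : Fin 2) (m : Mat2 A) : entry i j m = m i j := rfl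

theorem add_apply (m n : Mat2 A) (i j : Fin 2) : (m + n) i j = m i j + n i j := rfl
theorem smul_apply (r : ℝ) (m : Mat2 A) (i j : Fin 2) : (r • m) i j = r • m i j := rfl
theorem one_apply (i j : Fin 2) : (1 : Mat2 A) i j = (1 : Matrix (Fin 2) (Fin 2) A) i j := rfl
theorem mul_apply (m n : Mat2 A) (i j : Fin 2) :
    (m * n) i j = m i 0 * n 0 j + m i 1 * n 1 j :=
  (Matrix.mul_apply (M := m) (N := n)).trans (Fin.sum_univ_two _)

end Mat2

/-- The map `a ↦ N ⊗ a` for a real matrix `N`. -/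
def matTensor (N : Matrix (Fin 2) (Fin 2) ℝ) : A →L[ℝ] Mat2 A where
  toFun a := Matrix.of fun i j => N i j • a
  map_add' a b := Matrix.ext fun i j => smul_add (N i j) a b
  map_smul' r a := Matrix.ext fun i j => smul_comm (N i j) r a
  cont := continuous_pi fun i => continuous_pi fun j => continuous_id.const_smul (N i j)

/-- The map `m ↦ (s ↦ α(s) m)`. -/
def funTensor {M : Type*} [NormedRing M] [NormedAlgebra ℝ M] (α : C(I, ℝ)) : M →L[ℝ] Paths M :=
  LinearMap.mkContinuous
    { toFun := fun m => (⟨fun s => α s • m, by fun_prop⟩ : C(I, M))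
      map_add' := fun m n => ContinuousMap.ext fun s => smul_add (α s) m n
      map_smul' := fun r m => ContinuousMap.ext fun s => smul_comm (α s) r m } ‖α‖
    fun m => by
      refine Paths.norm_le _ (by positivity) fun s => ?_
      exact (norm_smul_le _ _).trans (mul_le_mul_of_nonneg_right (α.norm_coe_le_norm s)
        (norm_nonneg _))

@[simp] theorem funTensor_apply {M : Type*} [NormedRing M] [NormedAlgebra ℝ M] (α : C(I, ℝ))
    (m : M) (s : I) : funTensor α m s = α s • m := rfl

/-- The system matrix `((α a, β b + γ c), (β b - γ c, -α a))`. -/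
def sysMat (α β γ : C(I, ℝ)) : A × A × A →L[ℝ] Paths (Mat2 A) :=
  (funTensor α ∘L matTensor (A := A) !![1, 0; 0, -1]) ∘L ContinuousLinearMap.fst ℝ A (A × A) +
  (funTensor β ∘L matTensor (A := A) !![0, 1; 1, 0]) ∘L ContinuousLinearMap.fst ℝ A A ∘L
    ContinuousLinearMap.snd ℝ A (A × A) +
  (funTensor γ ∘L matTensor (A := A) !![0, 1; -1, 0]) ∘L ContinuousLinearMap.snd ℝ A A ∘L
    ContinuousLinearMap.snd ℝ A (A × A)

theorem sysMat_apply (α β γ : C(I, ℝ)) (a b c : A) (s : I) :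
    sysMat α β γ (a, b, c) s =
      !![α s • a, β s • b + γ s • c; β s • b - γ s • c, -(α s • a)] := by
  refine Matrix.ext fun i j => ?_
  have h : sysMat α β γ (a, b, c) s i j = α s • ((!![1, 0; 0, -1] : Matrix _ _ ℝ) i j • a) +
      β s • ((!![0, 1; 1, 0] : Matrix _ _ ℝ) i j • b) +
      γ s • ((!![0, 1; -1, 0] : Matrix _ _ ℝ) i j • c) := rfl
  rw [h]
  fin_cases i <;> fin_cases j <;> simp [sub_eq_add_neg]

variable [CompleteSpace A]

/-- For the solution `P = 1 + t Z` of the system at `s = 1`, the quotient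
`(P₁₁ P₂₁ - P₁₂ P₂₂) / t`. -/
def hatLoop (α β γ : C(I, ℝ)) (t : ℝ) (w : A × A × A) : A :=
  let Z := odeQuot t (sysMat α β γ w)
  Z 1 0 - Z 0 1 + t • (Z 0 0 * Z 1 0 - Z 0 1 * Z 1 1)

/-- The condition under which the Neumann series for the system makes sense. -/
def Solvable (α β γ : C(I, ℝ)) (t : ℝ) (w : A × A × A) : Prop :=
  NeumannInv t (volterra (sysMat α β γ w))

theorem solvable_zero (α β γ : C(I, ℝ)) (w : A × A × A) : Solvable α β γ 0 w :=
  neumannInv_zero _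

theorem isOpen_solvable (α β γ : C(I, ℝ)) :
    IsOpen {q : ℝ × A × A × A | Solvable α β γ q.1 q.2} := by
  have h : Continuous fun q : ℝ × A × A × A => (q.1, volterra (sysMat α β γ q.2)) :=
    continuous_fst.prodMk
      (volterra.continuous.comp ((sysMat α β γ).continuous.comp continuous_snd))
  exact isOpen_neumannInv.preimage h

theorem contDiffAt_hatLoop {α β γ : C(I, ℝ)} {t : ℝ} {w : A × A × A} (h : Solvable α β γ t w) :
    ContDiffAt ℝ ω (fun q : ℝ × A × A × A => hatLoop α β γ q.1 q.2) (t, w) := by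
  have h1 : ContDiffAt ℝ ω (fun q : ℝ × A × A × A => odeQuot q.1 (sysMat α β γ q.2)) (t, w) :=
    (contDiffAt_odeQuot h).comp (t, w)
      (contDiffAt_fst.prodMk ((sysMat α β γ).contDiff.contDiffAt.comp _ contDiffAt_snd))
  have h2 : ∀ i j, ContDiffAt ℝ ω
      (fun q : ℝ × A × A × A => odeQuot q.1 (sysMat α β γ q.2) i j) (t, w) := fun i j =>
    (Mat2.entry (A := A) i j).contDiff.contDiffAt.comp (t, w) h1
  exact ((h2 1 0).sub (h2 0 1)).add
    (ContDiffAt.smul (f := Prod.fst) contDiffAt_fst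
      (((h2 0 0).mul (h2 1 0)).sub ((h2 0 1).mul (h2 1 1))))

/-- At t = 0 the quotient Z is the integral of the system matrix, and Z₂₁ - Z₁₂ cancels the
symmetric off-diagonal part, leaving twice the antisymmetric one. -/
theorem hatLoop_zero (α β γ : C(I, ℝ)) (a b c : A) :
    hatLoop α β γ 0 (a, b, c) = (-2 * ∫ u in (0 : ℝ)..1, IccExtend zero_le_one γ u) • c := by
  have h : ∀ i j, primitive (sysMat α β γ (a, b, c)) 1 i j =
      ∫ u in (0 : ℝ)..1, IccExtend zero_le_one (sysMat α β γ (a, b, c)) u i j := fun i j =>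
    ((Mat2.entry i j).intervalIntegral_comp_comm
      (intervalIntegrable_IccExtend (sysMat α β γ (a, b, c)) 1)).symm
  have hi : ∀ (δ : C(I, ℝ)) (d : A), IntervalIntegrable
      (fun u => IccExtend zero_le_one δ u • d) MeasureTheory.volume 0 1 := fun δ d =>
    ((δ.continuous.Icc_extend' (h := zero_le_one)).smul continuous_const).intervalIntegrable 0 1
  simp only [hatLoop, zero_smul, add_zero, odeQuot_zero, h]
  simp only [IccExtend, Function.comp_apply, sysMat_apply]
  have h1 := intervalIntegral.integral_sub (hi β b) (hi γ c)
  have h2 := intervalIntegral.integral_add (hi β b) (hi γ c)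
  simp only [IccExtend, Function.comp_apply] at h1 h2
  have h3 := intervalIntegral.integral_smul_const (μ := MeasureTheory.volume) (a := 0) (b := 1)
    (IccExtend zero_le_one γ) c
  simp only [IccExtend, Function.comp_apply] at h3
  simp [h1, h2, h3]
  module

end MatrixODE

end DPW

namespace DPW

variable {ρ : ℝ}

/-! ## The potential in closed form -/

/-- The polynomial `∏ (z - p_k)`. -/
def punctPoly (φ : ℝ) (z : ℂ) : ℂ := (z ^ 2 + 1) ^ 2 - 4 * z ^ 2 * (Real.cos φ : ℂ) ^ 2

/-- The diagonal coefficient of the potential. -/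
def coefA (φ : ℝ) (z : ℂ) : ℂ :=
  -8 * z * (Real.sin φ : ℂ) * (Real.cos φ : ℂ) / punctPoly φ z
/-- The symmetric off-diagonal coefficient of the potential. -/
def coefB (φ : ℝ) (z : ℂ) : ℂ := 4 * (Real.cos φ : ℂ) * (z ^ 2 - 1) / punctPoly φ z
/-- The antisymmetric off-diagonal coefficient of the potential. -/
def coefC (φ : ℝ) (z : ℂ) : ℂ := -4 * (Real.sin φ : ℂ) * (z ^ 2 + 1) / punctPoly φ z

/-- The matrix `((α a, β b + γ c), (β b - γ c, -α a))`. -/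
def formMat (α β γ a b c : ℂ) : M2 := !![α * a, β * b + γ * c; β * b - γ * c, -(α * a)]

theorem cos_eq_exp (φ : ℝ) : (Real.cos φ : ℂ) = (exp (I * φ) + (exp (I * φ))⁻¹) / 2 := by
  rw [← exp_neg, ofReal_cos, Complex.cos]
  ring_nf

theorem sin_eq_exp (φ : ℝ) : (Real.sin φ : ℂ) = -I * (exp (I * φ) - (exp (I * φ))⁻¹) / 2 := by
  rw [← exp_neg, ofReal_sin, Complex.sin]
  ring_nf

theorem punctPoly_eq (φ : ℝ) (z : ℂ) : punctPoly φ z =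
    (z - exp (I * φ)) * (z + (exp (I * φ))⁻¹) * (z + exp (I * φ)) * (z - (exp (I * φ))⁻¹) := by
  have he := exp_ne_zero (I * φ)
  rw [punctPoly, cos_eq_exp]
  field_simp
  ring

theorem mem_range_punct (φ : ℝ) (z : ℂ) : z ∈ range (punct φ) ↔ punctPoly φ z = 0 := by
  rw [punctPoly_eq]
  simp only [mem_range, Fin.exists_fin_succ, punct, exp_neg]
  simp [sub_eq_zero, add_eq_zero_iff_eq_neg, or_assoc, eq_comm]

theorem potential_eq (φ t : ℝ) (x : Param ρ) (lam : ℂ) {z : ℂ} (hz : z ∉ range (punct φ)) :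
    potential φ t x lam z = ((x.r * t : ℝ) : ℂ) •
      formMat (coefA φ z) (coefB φ z) (coefC φ z) (x.a lam) (x.b φ lam) (x.c φ lam) := by
  rw [mem_range_punct, punctPoly_eq] at hz
  simp only [mul_eq_zero, not_or] at hz
  obtain ⟨⟨⟨h1, h2⟩, h3⟩, h4⟩ := hz
  -- Treating e = exp(iφ) and its inverse e' as independent turns the partial fraction identities
  -- into polynomial ones, which hold modulo the single relation e e' = 1.
  have he := mul_inv_cancel₀ (exp_ne_zero (I * φ))
  have hA : I * (1 / (z - exp (I * φ)) - 1 / (z + (exp (I * φ))⁻¹) + 1 / (z + exp (I * φ))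
      - 1 / (z - (exp (I * φ))⁻¹)) = coefA φ z := by
    rw [coefA, punctPoly_eq, cos_eq_exp, sin_eq_exp]
    generalize (exp (I * φ))⁻¹ = e' at *
    generalize exp (I * φ) = e at *
    field_simp
    ring
  have hB : 1 / (z - exp (I * φ)) - 1 / (z + (exp (I * φ))⁻¹) - 1 / (z + exp (I * φ))
      + 1 / (z - (exp (I * φ))⁻¹) = coefB φ z := by
    rw [coefB, punctPoly_eq, cos_eq_exp]
    generalize (exp (I * φ))⁻¹ = e' at *
    generalize exp (I * φ) = e at *
    field_simp
    linear_combination (-4 * (e + e')) * he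
  have hC : I * (1 / (z - exp (I * φ)) + 1 / (z + (exp (I * φ))⁻¹) - 1 / (z + exp (I * φ))
      - 1 / (z - (exp (I * φ))⁻¹)) = coefC φ z := by
    rw [coefC, punctPoly_eq, sin_eq_exp]
    generalize (exp (I * φ))⁻¹ = e' at *
    generalize exp (I * φ) = e at *
    field_simp
    linear_combination (4 * (e - e')) * he
  rw [potential, Fin.sum_univ_four, ← hA, ← hB, ← hC]
  congr 1
  ext i j
  fin_cases i <;> fin_cases j <;>
    simp [residue, punct, formMat, exp_neg] <;> ring

/-! ## Symmetries -/

theorem formMat_conj_D (α β γ a b c : ℂ) :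
    matD⁻¹ * formMat α β γ a b c * matD = formMat α (-β) (-γ) a b c := by
  have h : matD⁻¹ = !![-I, 0; 0, I] := Matrix.inv_eq_right_inv (by
    ext i j; fin_cases i <;> fin_cases j <;> simp [matD])
  rw [h]
  ext i j
  fin_cases i <;> fin_cases j <;> simp [matD, formMat, Matrix.mul_apply, Fin.sum_univ_two] <;>
    (try ring_nf; try simp; try ring)

theorem formMat_conj_C (α β γ a b c : ℂ) :
    matC⁻¹ * formMat α β γ a b c * matC = formMat (-α) β (-γ) a b c := by
  have h : matC⁻¹ = !![0, -I; -I, 0] := Matrix.inv_eq_right_inv (by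
    ext i j; fin_cases i <;> fin_cases j <;> simp [matC])
  rw [h]
  ext i j
  fin_cases i <;> fin_cases j <;> simp [matC, formMat, Matrix.mul_apply, Fin.sum_univ_two] <;>
    (try ring_nf; try simp; try ring)

theorem smul_formMat (k α β γ a b c : ℂ) :
    k • formMat α β γ a b c = formMat (k * α) (k * β) (k * γ) a b c := by
  ext i j
  fin_cases i <;> fin_cases j <;> simp [formMat] <;> ring

theorem smul_formMat' (k α β γ a b c : ℂ) :
    k • formMat α β γ a b c = formMat α β γ (k * a) (k * b) (k * c) := by
  ext i j
  fin_cases i <;> fin_cases j <;> simp [formMat] <;> ring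

theorem punctPoly_neg (φ : ℝ) (z : ℂ) : punctPoly φ (-z) = punctPoly φ z := by
  simp [punctPoly]

theorem punctPoly_inv (φ : ℝ) {z : ℂ} (hz : z ≠ 0) :
    punctPoly φ z⁻¹ = punctPoly φ z / z ^ 4 := by
  rw [punctPoly, punctPoly]
  field_simp
  ring

theorem punctPoly_conj (φ : ℝ) (z : ℂ) : punctPoly φ (conj z) = conj (punctPoly φ z) := by
  simp only [punctPoly, map_sub, map_mul, map_pow, map_add, map_one, conj_ofReal, map_ofNat]

theorem loopEval_conj (h : WRNonneg ρ) (lam : ℂ) : conj (loopEval h (conj lam)) = loopEval h lam := by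
  rw [loopEval, loopEval, conj_tsum]
  refine tsum_congr fun k => ?_
  rw [map_mul, map_zpow₀, conj_conj, h.2.2 k]

/-- Under z ↦ -z the diagonal coefficient is odd and the other two are even; under z ↦ 1/z, with the
factor -z⁻², the first and third change sign. Conjugation by D and C produces exactly these signs.
Reality of all coefficients gives σ. -/
theorem isSymmetric_potential (φ t : ℝ) (x : Param ρ) : IsSymmetric φ (potential φ t x) where
  delta lam _ z hz := by
    have hz' : -z ∉ range (punct φ) := by rwa [mem_range_punct, punctPoly_neg, ← mem_range_punct]
    rw [potential_eq φ t x lam hz, potential_eq φ t x lam hz', Matrix.mul_smul, Matrix.smul_mul,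
      formMat_conj_D, smul_comm, smul_formMat]
    simp [coefA, coefB, coefC, punctPoly_neg, neg_div]
  tau lam _ z hz hz0 := by
    have h4 := (mem_range_punct φ z).not.1 hz
    have hz' : z⁻¹ ∉ range (punct φ) := by
      rw [mem_range_punct, punctPoly_inv φ hz0]
      positivity
    rw [one_div, potential_eq φ t x lam hz, potential_eq φ t x lam hz', Matrix.mul_smul,
      Matrix.smul_mul, formMat_conj_C, smul_comm, smul_formMat]
    rw [coefA, coefB, coefC, coefA, coefB, coefC, punctPoly_inv φ hz0]
    congr 2 <;> field_simp <;> ring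
  sigma lam _ z hz := by
    have hz' : conj z ∉ range (punct φ) := by
      rw [mem_range_punct, punctPoly_conj]
      simpa using (mem_range_punct φ z).not.1 hz
    have ha : conj (x.a (conj lam)) = x.a lam := by
      simp [Param.a, loopEval_conj, map_ofNat, -ofReal_sin, -ofReal_cos]
    have hb : conj (x.b φ (conj lam)) = x.b φ lam := by
      simp [Param.b, loopEval_conj, map_ofNat, -ofReal_sin, -ofReal_cos]
    have hc : conj (x.c φ (conj lam)) = x.c φ lam := by
      simp [Param.c, loopEval_conj, map_ofNat, -ofReal_sin, -ofReal_cos]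
    have hA : conj (coefA φ (conj z)) = coefA φ z := by
      simp [coefA, punctPoly_conj, map_ofNat, -ofReal_sin, -ofReal_cos]
    have hB : conj (coefB φ (conj z)) = coefB φ z := by
      simp [coefB, punctPoly_conj, map_ofNat, -ofReal_sin, -ofReal_cos]
    have hC : conj (coefC φ (conj z)) = coefC φ z := by
      simp [coefC, punctPoly_conj, map_ofNat, -ofReal_sin, -ofReal_cos]
    rw [potential_eq φ t x lam hz, potential_eq φ t x (conj lam) hz', ← ha, ← hb, ← hc, ← hA,
      ← hB, ← hC]
    ext i j
    fin_cases i <;> fin_cases j <;> simp [formMat]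

/-! ## The DPW property -/

theorem differentiableOn_loopEval [Fact (1 < ρ)] (h : WRNonneg ρ) :
    DifferentiableOn ℂ (loopEval h) (Metric.ball 0 ρ) := by
  refine differentiableOn_tsum_of_summable_norm h.1.2 (fun k z hz => ?_) Metric.isOpen_ball
    fun k z hz => ?_
  · rcases lt_or_ge k 0 with hk | hk
    · simpa [h.2.1 k hk] using differentiableWithinAt_const (0 : ℂ)
    · exact ((differentiableAt_zpow.2 (Or.inr hk)).const_mul _).differentiableWithinAt
  · rcases lt_or_ge k 0 with hk | hk
    · simp [h.2.1 k hk]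
    · obtain ⟨n, rfl⟩ := Int.eq_ofNat_of_zero_le hk
      rw [norm_mul, norm_zpow, zpow_natCast, Int.natAbs_natCast]
      refine mul_le_mul_of_nonneg_left (pow_le_pow_left₀ (norm_nonneg z) ?_ n) (norm_nonneg _)
      exact (mem_ball_zero_iff.1 hz).le.trans (le_abs_self ρ)

/-- `λ a(λ)`, as a function on the disc. -/
def discA (x : Param ρ) (lam : ℂ) : ℂ := 1 / 2 * (1 - lam ^ 2) + lam * loopEval x.1 lam
/-- `λ b(λ)`, as a function on the disc. -/
def discB (φ : ℝ) (x : Param ρ) (lam : ℂ) : ℂ :=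
  -(1 / 2) * (Real.sin φ : ℂ) * (1 + lam ^ 2) + lam * loopEval x.2.1 lam
/-- `λ c(λ)`, as a function on the disc. -/
def discC (φ : ℝ) (x : Param ρ) (lam : ℂ) : ℂ :=
  -(1 / 2) * (Real.cos φ : ℂ) * (1 + lam ^ 2) + lam * loopEval x.2.2.1 lam

theorem discA_eq (x : Param ρ) {lam : ℂ} (h : lam ≠ 0) : discA x lam = lam * x.a lam := by
  rw [discA, Param.a]
  field_simp

theorem discB_eq (φ : ℝ) (x : Param ρ) {lam : ℂ} (h : lam ≠ 0) :
    discB φ x lam = lam * x.b φ lam := by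
  rw [discB, Param.b]
  field_simp

theorem discC_eq (φ : ℝ) (x : Param ρ) {lam : ℂ} (h : lam ≠ 0) :
    discC φ x lam = lam * x.c φ lam := by
  rw [discC, Param.c]
  field_simp

theorem analyticAt_loopEval [hρ : Fact (1 < ρ)] (h : WRNonneg ρ) {z : ℂ}
    (hz : z ∈ Metric.closedBall (0 : ℂ) 1) : AnalyticAt ℂ (loopEval h) z :=
  (differentiableOn_loopEval h).analyticAt (Metric.isOpen_ball.mem_nhds
    (Metric.closedBall_subset_ball hρ.out hz))

/-- The sign ε covers both charts at once: ε = 1 is the chart z, and ε = -1 is the chart 1/z, where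
conjugation by C flips the first and third coefficients. -/
theorem isDPWChart_formMat [Fact (1 < ρ)] {φ t : ℝ} (hφ : φ ∈ Ioo 0 (Real.pi / 2)) {x : Param ρ}
    (hx : x.r * t ≠ 0) {U : Set ℂ} (hU : U = (range (punct φ))ᶜ) {E : ℂ → ℂ → M2} {ε : ℂ}
    (hε : ε ^ 2 = 1)
    (hE : ∀ lam, lam ≠ 0 → ∀ z ∈ U, E lam z = ((x.r * t : ℝ) : ℂ) •
      formMat (ε * coefA φ z) (coefB φ z) (ε * coefC φ z) (x.a lam) (x.b φ lam) (x.c φ lam)) :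
    IsDPWChart U E := by
  have hs : (Real.sin φ : ℂ) ≠ 0 := by
    exact_mod_cast (Real.sin_pos_of_pos_of_lt_pi hφ.1 (by linarith [hφ.2, Real.pi_pos])).ne'
  have hc : (Real.cos φ : ℂ) ≠ 0 := by
    exact_mod_cast (Real.cos_pos_of_mem_Ioo ⟨by linarith [hφ.1, Real.pi_pos], hφ.2⟩).ne'
  have hx' : ((x.r * t : ℝ) : ℂ) ≠ 0 := by exact_mod_cast hx
  have hε0 : ε ≠ 0 := by rintro rfl; simp at hε
  have hd : ∀ z ∈ U, punctPoly φ z ≠ 0 := fun z hz => by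
    rw [hU] at hz
    exact (mem_range_punct φ z).not.1 hz
  refine ⟨fun lam z => ((x.r * t : ℝ) : ℂ) • formMat (ε * coefA φ z) (coefB φ z) (ε * coefC φ z)
    (discA x lam) (discB φ x lam) (discC φ x lam), ?_, ?_, ?_, ?_⟩
  · rintro i j ⟨lam, z⟩ ⟨hlam, hz⟩
    have hdz : punctPoly φ z ≠ 0 := hd z hz
    have hp : AnalyticAt ℂ (punctPoly φ) z := by unfold punctPoly; fun_prop
    have hA : AnalyticAt ℂ (coefA φ) z := AnalyticAt.div (by fun_prop) hp hdz
    have hB : AnalyticAt ℂ (coefB φ) z := AnalyticAt.div (by fun_prop) hp hdz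
    have hC : AnalyticAt ℂ (coefC φ) z := AnalyticAt.div (by fun_prop) hp hdz
    have h1 := analyticAt_loopEval x.1 hlam
    have h2 := analyticAt_loopEval x.2.1 hlam
    have h3 := analyticAt_loopEval x.2.2.1 hlam
    have ha : AnalyticAt ℂ (discA x) lam := by unfold discA; fun_prop
    have hb : AnalyticAt ℂ (discB φ x) lam := by unfold discB; fun_prop
    have hc : AnalyticAt ℂ (discC φ x) lam := by unfold discC; fun_prop
    have hz1 : AnalyticAt ℂ (Prod.fst : ℂ × ℂ → ℂ) (lam, z) := analyticAt_fst
    have hz2 : AnalyticAt ℂ (Prod.snd : ℂ × ℂ → ℂ) (lam, z) := analyticAt_snd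
    have hA' := hA.fun_comp hz2
    have hB' := hB.fun_comp hz2
    have hC' := hC.fun_comp hz2
    have ha' := ha.fun_comp hz1
    have hb' := hb.fun_comp hz1
    have hc' := hc.fun_comp hz1
    have hk : ∀ k : ℂ, AnalyticAt ℂ (fun _ : ℂ × ℂ => k) (lam, z) := fun k => analyticAt_const
    have e0 := (hk (x.r * t)).mul (((hk ε).mul hA').mul ha')
    have e1 := hB'.mul hb'
    have e2 := ((hk ε).mul hC').mul hc'
    fin_cases i <;> fin_cases j
    · exact e0.congr (.of_forall fun q => by simp [formMat])
    · exact ((hk (x.r * t)).mul (e1.add e2)).congr (.of_forall fun q => by simp [formMat])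
    · exact ((hk (x.r * t)).mul (e1.sub e2)).congr (.of_forall fun q => by simp [formMat])
    · exact e0.neg.congr (.of_forall fun q => by simp [formMat])
  · intro lam hlam z hz
    have hlam0 : lam ≠ 0 := norm_pos_iff.1 (by rw [mem_sphere_zero_iff_norm.1 hlam]; exact one_pos)
    beta_reduce
    rw [hE lam hlam0 z hz, discA_eq x hlam0, discB_eq φ x hlam0, discC_eq φ x hlam0,
      ← smul_formMat', smul_smul, smul_smul, mul_comm]
  · intro lam _ z _
    simp [Matrix.trace_fin_two, formMat]
  · intro z hz
    have hdz := hd z hz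
    -- At λ = 0 the discs contribute only 1/2, -sin φ/2, -cos φ/2, and the factor 4 sin φ cos φ /
    -- ∏(z - p_k), nonzero on the domain, splits off.
    have h0 : (formMat (ε * coefA φ z) (coefB φ z) (ε * coefC φ z)
        (discA x 0) (discB φ x 0) (discC φ x 0)) =
        (4 * Real.sin φ * Real.cos φ / punctPoly φ z : ℂ) •
          !![-(ε * z), -((z ^ 2 - 1) - ε * (z ^ 2 + 1)) / 2;
            -((z ^ 2 - 1) + ε * (z ^ 2 + 1)) / 2, ε * z] := by
      ext i j
      fin_cases i <;> fin_cases j <;>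
        simp [formMat, coefA, coefB, coefC, discA, discB, discC, -ofReal_sin, -ofReal_cos] <;>
        field_simp <;> ring
    have hk : (4 * Real.sin φ * Real.cos φ / punctPoly φ z : ℂ) ≠ 0 :=
      div_ne_zero (mul_ne_zero (mul_ne_zero (by norm_num) hs) hc) hdz
    beta_reduce
    rw [h0]
    refine ⟨fun h => ?_, ⟨2, ?_⟩⟩
    · rw [smul_eq_zero_iff_right hx', smul_eq_zero_iff_right hk] at h
      have e1 := congrFun (congrFun h 0) 0
      have e2 := congrFun (congrFun h 0) 1
      have e3 := congrFun (congrFun h 1) 0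
      simp [hε0] at e1 e2 e3
      subst e1
      -- The diagonal entry forces z = 0, where the off-diagonal entries are (1 ± ε)/2; they cannot
      -- both vanish.
      have : (2 : ℂ) = 0 := by linear_combination e2 + e3
      norm_num at this
    · rw [pow_two, Matrix.smul_mul, Matrix.mul_smul, Matrix.smul_mul, Matrix.mul_smul]
      have : (!![-(ε * z), -((z ^ 2 - 1) - ε * (z ^ 2 + 1)) / 2;
            -((z ^ 2 - 1) + ε * (z ^ 2 + 1)) / 2, ε * z] : M2) *
          !![-(ε * z), -((z ^ 2 - 1) - ε * (z ^ 2 + 1)) / 2;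
            -((z ^ 2 - 1) + ε * (z ^ 2 + 1)) / 2, ε * z] = 0 := by
        ext i j
        fin_cases i <;> fin_cases j <;> simp [Matrix.mul_apply, Fin.sum_univ_two]
        · linear_combination (z ^ 2 - (z ^ 2 + 1) ^ 2 / 4) * hε
        · ring
        · ring
        · linear_combination (z ^ 2 - (z ^ 2 + 1) ^ 2 / 4) * hε
      rw [this]
      simp

/-- The τ-symmetry supplies the chart at infinity: in w = 1/z the potential is its own conjugate by
C, and the set of punctures is stable under inversion. -/
theorem isDPWPotential_potential [Fact (1 < ρ)] {φ t : ℝ} (hφ : φ ∈ Ioo 0 (Real.pi / 2))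
    {x : Param ρ} (hx : x.r * t ≠ 0) : IsDPWPotential φ (potential φ t x) := by
  have hset : {w : ℂ | w = 0 ∨ w⁻¹ ∉ range (punct φ)} = (range (punct φ))ᶜ := by
    ext w
    rcases eq_or_ne w 0 with rfl | hw
    · simp only [mem_ofPred_eq, mem_compl_iff, mem_range_punct]
      simp [punctPoly]
    · simp only [mem_ofPred_eq, mem_compl_iff, mem_range_punct, punctPoly_inv φ hw]
      simp [hw]
  refine ⟨isDPWChart_formMat hφ hx rfl (ε := 1) (by norm_num) fun lam _ z hz => by
      rw [potential_eq φ t x lam hz, one_mul, one_mul],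
    fun lam w => matC⁻¹ * potential φ t x lam w * matC,
    isDPWChart_formMat hφ hx hset (ε := -1) (by norm_num) fun lam _ z hz => ?_,
    fun lam hlam w hw hw' => ?_⟩
  · rw [hset] at hz
    rw [potential_eq φ t x lam hz, Matrix.mul_smul, Matrix.smul_mul, formMat_conj_C, neg_one_mul,
      neg_one_mul]
  · have hw2 : w ∈ (range (punct φ))ᶜ := hset ▸ (Or.inr hw' : w ∈ {w : ℂ | w = 0 ∨ _})
    have h := (isSymmetric_potential φ t x).tau lam hlam w hw2 hw
    rw [one_div] at h
    exact h.symm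

end DPW

namespace DPW
open scoped ContDiff

variable {ρ : ℝ} [hρ : Fact (1 < ρ)]

/-! ## Nonnegative real loops inside the Banach algebra -/

set_option linter.unusedSectionVars false

theorem WRNonneg.ofReal_re_coeff (h : WRNonneg ρ) (k : ℤ) :
    ((h.1.1.coeff k).re : ℂ) = h.1.1.coeff k :=
  conj_eq_iff_re.1 (h.2.2 k)

theorem WRNonneg.abs_re_coeff (h : WRNonneg ρ) (k : ℤ) :
    |(h.1.1.coeff k).re| = ‖h.1.1.coeff k‖ := by
  rw [← Real.norm_eq_abs, ← Complex.norm_real, WRNonneg.ofReal_re_coeff h]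

theorem WRNonneg.summable_re_coeff (h : WRNonneg ρ) :
    Summable fun k => |(h.1.1.coeff k).re| * wt ρ k := by
  have hs : Summable fun k : ℤ => ‖h.1.1.coeff k‖ * |ρ| ^ k.natAbs := h.1.2
  refine hs.congr fun k => ?_
  rw [WRNonneg.abs_re_coeff h, wt]

/-- The inclusion of the nonnegative real loops. -/
def incl : WRNonneg ρ →ₗᵢ[ℝ] RLoop ρ where
  toFun h := RLoop.mk (fun k => (h.1.1.coeff k).re) (WRNonneg.summable_re_coeff h)
  map_add' f g := RLoop.ext fun k => by simp
  map_smul' r f := RLoop.ext fun k => by simp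
  norm_map' h := by
    refine (RLoop.norm_eq _).trans (tsum_congr fun k => ?_)
    have h1 := congrArg (|·| * wt ρ k)
      (RLoop.coeff_mk (fun k => (h.1.1.coeff k).re) (WRNonneg.summable_re_coeff h) k)
    exact h1.trans (congrArg (· * wt ρ k) (WRNonneg.abs_re_coeff h k))

@[simp] theorem coeff_incl (h : WRNonneg ρ) (k : ℤ) :
    (incl h).coeff k = (h.1.1.coeff k).re :=
  RLoop.coeff_mk _ (WRNonneg.summable_re_coeff h) k

theorem coeff_incl_of_neg (h : WRNonneg ρ) {k : ℤ} (hk : k < 0) : (incl h).coeff k = 0 := by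
  simp [h.2.1 k hk]

theorem ev_incl {z : ℂ} (hz : ‖z‖ = 1) (h : WRNonneg ρ) : RLoop.ev z (incl h) = loopEval h z := by
  rw [← (RLoop.hasSum_ev hz (incl h)).tsum_eq, loopEval]
  refine tsum_congr fun k => ?_
  rw [coeff_incl, WRNonneg.ofReal_re_coeff h]

/-- The coefficients of the nonnegative part of a loop. -/
def truncCoeffs (f : RLoop ρ) : Coeffs := fun k => if 0 ≤ k then (f.coeff k : ℂ) else 0

theorem coeff_truncCoeffs (f : RLoop ρ) (k : ℤ) :
    (truncCoeffs f).coeff k = if 0 ≤ k then (f.coeff k : ℂ) else 0 := rfl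

theorem norm_coeff_truncCoeffs_le (f : RLoop ρ) (k : ℤ) :
    ‖(truncCoeffs f).coeff k‖ * |ρ| ^ k.natAbs ≤ |f.coeff k| * wt ρ k := by
  refine mul_le_mul_of_nonneg_right ?_ (wt_pos ρ k).le
  rw [coeff_truncCoeffs]
  split_ifs <;> simp

theorem summable_truncCoeffs (f : RLoop ρ) :
    Summable fun k : ℤ => ‖(truncCoeffs f).coeff k‖ * |ρ| ^ k.natAbs :=
  Summable.of_nonneg_of_le (fun _ => by positivity) (norm_coeff_truncCoeffs_le f) f.summable_coeff

/-- The nonnegative part of a loop. -/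
def trunc : RLoop ρ →L[ℝ] WRNonneg ρ :=
  LinearMap.mkContinuous
    { toFun := fun f => ⟨⟨truncCoeffs f, summable_truncCoeffs f⟩,
        fun k hk => if_neg (not_le.2 hk), fun k => by
          rw [coeff_truncCoeffs]
          split_ifs <;> simp⟩
      map_add' := fun f g => Subtype.ext (Subtype.ext (funext fun k => by
        change (truncCoeffs (f + g)).coeff k = (truncCoeffs f).coeff k + (truncCoeffs g).coeff k
        simp only [coeff_truncCoeffs]
        split_ifs <;> simp))
      map_smul' := fun r f => Subtype.ext (Subtype.ext (funext fun k => by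
        change (truncCoeffs (r • f)).coeff k = r • (truncCoeffs f).coeff k
        simp only [coeff_truncCoeffs]
        split_ifs <;> simp)) } 1
    fun f => by
      rw [one_mul, RLoop.norm_eq]
      exact Summable.tsum_le_tsum (norm_coeff_truncCoeffs_le f) (summable_truncCoeffs f)
        f.summable_coeff

theorem coeff_trunc (f : RLoop ρ) (k : ℤ) :
    (trunc f).1.1.coeff k = if 0 ≤ k then (f.coeff k : ℂ) else 0 := rfl

theorem coeff_incl_trunc (f : RLoop ρ) (k : ℤ) :
    (incl (trunc f)).coeff k = if 0 ≤ k then f.coeff k else 0 := by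
  rw [coeff_incl, coeff_trunc]
  split_ifs <;> simp

theorem incl_trunc_eq {f : RLoop ρ} (hf : ∀ k < 0, f.coeff k = 0) : incl (trunc f) = f :=
  RLoop.ext fun k => by
    rw [coeff_incl_trunc]
    split_ifs with hk
    · rfl
    · exact (hf k (not_le.1 hk)).symm

theorem trunc_incl (h : WRNonneg ρ) : trunc (incl h) = h :=
  incl.injective (incl_trunc_eq fun _ hk => coeff_incl_of_neg h hk)

theorem trunc_eq_zero_iff (f : RLoop ρ) : trunc f = 0 ↔ ∀ k, 0 ≤ k → f.coeff k = 0 := by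
  rw [← incl.injective.eq_iff, map_zero]
  constructor
  · intro h k hk
    have := congrArg (fun g => RLoop.coeff g k) h
    simpa only [coeff_incl_trunc, if_pos hk, RLoop.coeff_zero] using this
  · intro h
    refine RLoop.ext fun k => ?_
    rw [coeff_incl_trunc, RLoop.coeff_zero]
    split_ifs with hk
    · exact h k hk
    · rfl

/-- The nonnegative loops are the fixed points of the continuous projection `incl ∘ trunc`, hence
closed in a complete space. The implicit function theorem needs this. -/
instance : CompleteSpace (WRNonneg ρ) := by
  rw [completeSpace_iff_isComplete_range (incl (ρ := ρ)).isometry.isUniformInducing]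
  refine IsClosed.isComplete ?_
  have : range (incl : WRNonneg ρ → RLoop ρ) = {f | incl (trunc f) = f} := by
    ext f
    constructor
    · rintro ⟨h, rfl⟩
      exact congrArg incl (trunc_incl h)
    · intro h
      exact ⟨trunc f, h⟩
  rw [this]
  exact isClosed_eq ((incl (ρ := ρ)).continuous.comp (trunc (ρ := ρ)).continuous) continuous_id

/-! ### Products of nonnegative loops -/

theorem RLoop.coeff_mul_of_neg {f g : RLoop ρ} (hf : ∀ k < 0, f.coeff k = 0)
    (hg : ∀ k < 0, g.coeff k = 0) {k : ℤ} (hk : k < 0) : (f * g).coeff k = 0 := by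
  rw [RLoop.coeff_mul]
  refine (tsum_congr fun j => ?_).trans tsum_zero
  rcases lt_or_ge j 0 with hj | hj
  · rw [hf j hj, zero_mul]
  · rw [hg (k - j) (by omega), mul_zero]

/-- The left shift by `n` places `h ↦ (λ⁻ⁿ h)_{≥ 0}`. -/
def leftShift (n : ℕ) : WRNonneg ρ →L[ℝ] WRNonneg ρ :=
  trunc ∘L (ContinuousLinearMap.mul ℝ (RLoop ρ) (RLoop.X (-n))) ∘L incl.toContinuousLinearMap

theorem leftShift_apply (n : ℕ) (h : WRNonneg ρ) :
    leftShift n h = trunc (RLoop.X (-n) * incl h) := rfl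

theorem coeff_incl_leftShift (n : ℕ) (h : WRNonneg ρ) (k : ℤ) :
    (incl (leftShift n h)).coeff k = if 0 ≤ k then (incl h).coeff (k + n) else 0 := by
  rw [leftShift_apply, coeff_incl_trunc, RLoop.coeff_X_mul, sub_neg_eq_add]

/-- Moving a coefficient two places to the left divides its weight by ρ², and the coefficients of
index 0 and 1 are dropped; so the norm is at most ρ⁻² < 1. -/
theorem norm_leftShift_two_lt : ‖(leftShift 2 : WRNonneg ρ →L[ℝ] WRNonneg ρ)‖ < 1 := by
  have hr := hρ.out
  have hr1 : (ρ ^ 2)⁻¹ < 1 := inv_lt_one_of_one_lt₀ (one_lt_pow₀ hr two_ne_zero)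
  refine lt_of_le_of_lt (ContinuousLinearMap.opNorm_le_bound _ (by positivity) fun h => ?_) hr1
  rw [← incl.norm_map (leftShift 2 h), ← incl.norm_map h, RLoop.norm_eq, RLoop.norm_eq,
    ← tsum_mul_left]
  have hs : Summable fun k : ℤ =>
      (ρ ^ 2)⁻¹ * (|(incl h).coeff (k + 2)| * wt ρ (k + 2)) :=
    ((Equiv.addRight (2 : ℤ)).summable_iff.2 (incl h).summable_coeff).mul_left _
  refine (Summable.tsum_le_tsum (fun k => ?_) (incl (leftShift 2 h)).summable_coeff hs).trans_eq
    ((Equiv.addRight (2 : ℤ)).tsum_eq fun k => (ρ ^ 2)⁻¹ * (|(incl h).coeff k| * wt ρ k))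
  rw [coeff_incl_leftShift]
  split_ifs with hk
  · obtain ⟨n, rfl⟩ := Int.eq_ofNat_of_zero_le hk
    have : wt ρ ((n : ℤ) + 2) = ρ ^ 2 * wt ρ n := by
      rw [wt, wt, RLoop.abs_rho, show ((n : ℤ) + 2).natAbs = n + 2 by omega, Int.natAbs_natCast]
      ring
    refine le_of_eq ?_
    push_cast
    rw [this]
    field_simp
  · rw [abs_zero, zero_mul]
    have := wt_pos ρ (k + 2)
    positivity

theorem bijective_one_sub_leftShift :
    Function.Bijective (1 - leftShift 2 : WRNonneg ρ →L[ℝ] WRNonneg ρ) := by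
  have h := isUnit_one_sub_of_norm_lt_one (R := WRNonneg ρ →L[ℝ] WRNonneg ρ)
    (x := leftShift 2) norm_leftShift_two_lt
  exact (Module.End.isUnit_iff _).1 (h.map ContinuousLinearMap.toLinearMapRingHom)

/-- Division by `1 - λ²` with a remainder of degree one: existence. -/
theorem exists_div_one_sub_sq (f : WRNonneg ρ) : ∃ (g : WRNonneg ρ) (α β : ℝ),
    (1 - RLoop.X 2) * incl g = incl f + α • 1 + β • RLoop.X 1 := by
  -- In degrees k ≥ 2 the division asks for g_k - g_(k-2) = f_k; shifted down by two this is (1 -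
  -- S)g = -S f for S the double left shift. Degrees 0 and 1 are left to the remainder.
  obtain ⟨g, hg⟩ := bijective_one_sub_leftShift.2 (-(leftShift 2 f))
  have h1 : ∀ k : ℤ, 0 ≤ k →
      (incl g).coeff k - (incl g).coeff (k + 2) = -(incl f).coeff (k + 2) := fun k hk => by
    have h2 := congrArg (fun h => (incl h).coeff k) hg
    have h3 : incl ((1 - leftShift 2 : WRNonneg ρ →L[ℝ] WRNonneg ρ) g) =
      incl g - incl (leftShift 2 g) := map_sub incl _ _
    simp only [h3, map_neg, RLoop.coeff_sub, RLoop.coeff_neg, coeff_incl_leftShift,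
      if_pos hk] at h2
    exact_mod_cast h2
  refine ⟨g, (incl g).coeff 0 - (incl f).coeff 0, (incl g).coeff 1 - (incl f).coeff 1,
    RLoop.ext fun k => ?_⟩
  rw [sub_mul, one_mul, RLoop.coeff_sub, RLoop.coeff_X_mul, RLoop.coeff_add, RLoop.coeff_add,
    RLoop.coeff_smul, RLoop.coeff_smul, RLoop.one_def, RLoop.coeff_X, RLoop.coeff_X]
  rcases lt_trichotomy k 0 with hk | rfl | hk
  · rw [coeff_incl_of_neg g hk, coeff_incl_of_neg f hk, coeff_incl_of_neg g (by omega),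
      Pi.single_eq_of_ne hk.ne, Pi.single_eq_of_ne (by omega)]
    ring
  · rw [coeff_incl_of_neg g (k := 0 - 2) (by omega), Pi.single_eq_same,
      Pi.single_eq_of_ne (by omega)]
    ring
  · rcases eq_or_ne k 1 with rfl | hk1
    · rw [coeff_incl_of_neg g (k := 1 - 2) (by omega), Pi.single_eq_same,
      Pi.single_eq_of_ne (by omega)]
      ring
    · have h2 := h1 (k - 2) (by omega)
      rw [sub_add_cancel] at h2
      rw [Pi.single_eq_of_ne hk1, Pi.single_eq_of_ne hk.ne']
      linarith

/-- Division by `1 - λ²` with a remainder of degree one: uniqueness. -/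
theorem div_one_sub_sq_unique {g : WRNonneg ρ} {α β : ℝ}
    (h : (1 - RLoop.X 2) * incl g = α • 1 + β • RLoop.X 1) : g = 0 ∧ α = 0 ∧ β = 0 := by
  have hc : ∀ k : ℤ, (incl g).coeff k - (incl g).coeff (k - 2) =
      α * (Pi.single 0 1 : ℤ → ℝ) k + β * (Pi.single 1 1 : ℤ → ℝ) k := fun k => by
    have := congrArg (fun f => RLoop.coeff f k) h
    rwa [sub_mul, one_mul, RLoop.coeff_sub, RLoop.coeff_X_mul, RLoop.coeff_add,
      RLoop.coeff_smul, RLoop.coeff_smul, RLoop.one_def, RLoop.coeff_X, RLoop.coeff_X] at this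
  have hg : g = 0 := by
    refine bijective_one_sub_leftShift.1 (incl.injective ?_)
    rw [map_zero, map_zero]
    have h3 : incl ((1 - leftShift 2 : WRNonneg ρ →L[ℝ] WRNonneg ρ) g) =
      incl g - incl (leftShift 2 g) := map_sub incl _ _
    rw [h3]
    refine RLoop.ext fun k => ?_
    rw [RLoop.coeff_sub, coeff_incl_leftShift, RLoop.coeff_zero]
    split_ifs with hk
    · have h2 := hc (k + 2)
      rw [Pi.single_eq_of_ne (by omega), Pi.single_eq_of_ne (by omega), add_sub_cancel_right] at h2
      push_cast
      linarith
    · rw [coeff_incl_of_neg g (not_le.1 hk), sub_zero]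
  subst hg
  refine ⟨rfl, ?_, ?_⟩
  · simpa using (hc 0).symm
  · simpa using (hc 1).symm

end DPW

namespace DPW

/-! ## The equation along the two segments -/

section Segments

open scoped unitInterval

/-- The polynomial `∏ (s - p_k)` on the real axis. -/
def segPoly (φ s : ℝ) : ℝ := (s ^ 2 - 1) ^ 2 + 4 * s ^ 2 * Real.sin φ ^ 2

theorem segPoly_pos {φ : ℝ} (h : Real.sin φ ≠ 0) (s : ℝ) : 0 < segPoly φ s := by
  rw [segPoly]
  rcases eq_or_ne s 0 with rfl | hs
  · norm_num
  · positivity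

theorem continuous_segPoly (φ : ℝ) : Continuous (segPoly φ) := by
  unfold segPoly
  fun_prop

/-- The quotient of a continuous function by `segPoly`. -/
def segMap (φ : ℝ) (h : Real.sin φ ≠ 0) (f : ℝ → ℝ) (hf : Continuous f) : C(I, ℝ) :=
  ⟨fun s => f s / segPoly φ s,
    (hf.comp continuous_subtype_val).div ((continuous_segPoly φ).comp continuous_subtype_val)
      fun s => (segPoly_pos h s).ne'⟩

/-- The diagonal coefficient on the unit segment. -/
def segA (φ : ℝ) (h : Real.sin φ ≠ 0) : C(I, ℝ) :=
  segMap φ h (fun s => -8 * s * Real.sin φ * Real.cos φ) (by fun_prop)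
/-- The symmetric off-diagonal coefficient on the unit segment. -/
def segB (φ : ℝ) (h : Real.sin φ ≠ 0) : C(I, ℝ) :=
  segMap φ h (fun s => 4 * Real.cos φ * (s ^ 2 - 1)) (by fun_prop)
/-- The antisymmetric off-diagonal coefficient on the unit segment. -/
def segC (φ : ℝ) (h : Real.sin φ ≠ 0) : C(I, ℝ) :=
  segMap φ h (fun s => -4 * Real.sin φ * (s ^ 2 + 1)) (by fun_prop)

theorem ofReal_segPoly (φ s : ℝ) : (segPoly φ s : ℂ) = punctPoly φ s := by
  rw [segPoly, punctPoly, Real.sin_sq]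
  push_cast
  ring

/-- Rotation by a quarter turn carries the punctures of angle π/2 - φ to those of angle φ, so the
imaginary axis looks like the real axis for the complementary angle. -/
theorem ofReal_segPoly_compl (φ s : ℝ) :
    (segPoly (Real.pi / 2 - φ) s : ℂ) = punctPoly φ (s * Complex.I) := by
  rw [segPoly, punctPoly, Real.sin_pi_div_two_sub, mul_pow, Complex.I_sq]
  push_cast
  ring

theorem ofReal_segA (φ : ℝ) (h : Real.sin φ ≠ 0) (s : I) : (segA φ h s : ℂ) = coefA φ s := by
  simp [segA, segMap, coefA, ← ofReal_segPoly]

theorem ofReal_segB (φ : ℝ) (h : Real.sin φ ≠ 0) (s : I) : (segB φ h s : ℂ) = coefB φ s := by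
  simp [segB, segMap, coefB, ← ofReal_segPoly]

theorem ofReal_segC (φ : ℝ) (h : Real.sin φ ≠ 0) (s : I) : (segC φ h s : ℂ) = coefC φ s := by
  simp [segC, segMap, coefC, ← ofReal_segPoly]

variable (φ : ℝ) (h : Real.sin (Real.pi / 2 - φ) ≠ 0)

theorem coefA_mul_I (s : I) :
    coefA φ ((s : ℝ) * Complex.I) = Complex.I * segA (Real.pi / 2 - φ) h s := by
  simp [segA, segMap, coefA, ← ofReal_segPoly_compl, Real.sin_pi_div_two_sub,
    Real.cos_pi_div_two_sub, -ofReal_sin, -ofReal_cos]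
  ring

theorem coefB_mul_I (s : I) : coefB φ ((s : ℝ) * Complex.I) = segC (Real.pi / 2 - φ) h s := by
  simp [segC, segMap, coefB, ← ofReal_segPoly_compl, Real.sin_pi_div_two_sub, mul_pow,
    -ofReal_sin, -ofReal_cos]
  ring

theorem coefC_mul_I (s : I) : coefC φ ((s : ℝ) * Complex.I) = segB (Real.pi / 2 - φ) h s := by
  simp [segB, segMap, coefC, ← ofReal_segPoly_compl, Real.cos_pi_div_two_sub, mul_pow,
    -ofReal_sin, -ofReal_cos]
  ring

/-- The integral of the antisymmetric coefficient. -/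
theorem integral_segC {φ : ℝ} (hφ : φ ∈ Ioo 0 (Real.pi / 2)) (h : Real.sin φ ≠ 0) :
    ∫ u in (0 : ℝ)..1, IccExtend zero_le_one (segC φ h) u = -Real.pi := by
  have hs : 0 < Real.sin φ := Real.sin_pos_of_pos_of_lt_pi hφ.1 (by linarith [hφ.2, Real.pi_pos])
  have hc : 0 < Real.cos φ := Real.cos_pos_of_mem_Ioo ⟨by linarith [hφ.1, Real.pi_pos], hφ.2⟩
  have hsc := Real.sin_sq_add_cos_sq φ
  set sn := Real.sin φ
  set cs := Real.cos φ
  have hc1 : cs < 1 := by nlinarith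
  -- The denominator factors as ((s - cos φ)² + sin² φ)((s + cos φ)² + sin² φ), and partial
  -- fractions give the two arctangents.
  have hd : ∀ s : ℝ, HasDerivAt
      (fun s => -2 * (Real.arctan ((s - cs) / sn) + Real.arctan ((s + cs) / sn)))
      (-4 * sn * (s ^ 2 + 1) / segPoly φ s) s := fun s => by
    have h1 := (((hasDerivAt_id s).sub_const cs).div_const sn).arctan
    have h2 := (((hasDerivAt_id s).add_const cs).div_const sn).arctan
    refine ((h1.add h2).const_mul (-2)).congr_deriv ?_
    have e1 : segPoly φ s = (sn ^ 2 + (s - cs) ^ 2) * (sn ^ 2 + (s + cs) ^ 2) := by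
      change (s ^ 2 - 1) ^ 2 + 4 * s ^ 2 * sn ^ 2 = _
      linear_combination (-(sn ^ 2 + cs ^ 2 + 1) + 2 * s ^ 2) * hsc
    have p1 : sn ^ 2 + (s - cs) ^ 2 ≠ 0 := by positivity
    have p2 : sn ^ 2 + (s + cs) ^ 2 ≠ 0 := by positivity
    rw [e1]
    simp only [id]
    field_simp
    linear_combination (-4 : ℝ) * hsc
  have hi : ∫ u in (0 : ℝ)..1, IccExtend zero_le_one (segC φ h) u =
      ∫ u in (0 : ℝ)..1, -4 * sn * (u ^ 2 + 1) / segPoly φ u := by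
    refine intervalIntegral.integral_congr fun u hu => ?_
    rw [uIcc_of_le zero_le_one] at hu
    exact IccExtend_of_mem zero_le_one (segC φ h) hu
  have hcont : Continuous fun u : ℝ => -4 * sn * (u ^ 2 + 1) / segPoly φ u :=
    Continuous.div (by fun_prop) (continuous_segPoly φ) fun u => (segPoly_pos h u).ne'
  rw [hi, intervalIntegral.integral_eq_sub_of_hasDerivAt (fun s _ => hd s)
    (hcont.intervalIntegrable 0 1)]
  -- At 0 the two arguments are opposite. At 1 they are positive and reciprocal, since (1 - cos φ)(1
  -- + cos φ) = sin² φ, so the arctangents add up to π/2.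
  have e0 : Real.arctan ((0 - cs) / sn) + Real.arctan ((0 + cs) / sn) = 0 := by
    rw [zero_sub, neg_div, Real.arctan_neg, zero_add, neg_add_cancel]
  have e1 : Real.arctan ((1 - cs) / sn) + Real.arctan ((1 + cs) / sn) = Real.pi / 2 := by
    have : (1 + cs) / sn = ((1 - cs) / sn)⁻¹ := by
      rw [inv_div, div_eq_div_iff hs.ne' (by linarith)]
      linarith
    rw [this, Real.arctan_inv_of_pos (div_pos (by linarith) hs)]
    ring
  rw [e0, e1]
  ring

end Segments

/-! ### Uniqueness of the principal solution -/

/-- `principal` picks some solution, so uniqueness is needed to identify its endpoint. The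
right-hand side is Lipschitz in the sup norm with constant 2K, each entry being a sum of two
products. -/
theorem IsFrameAlong.eq_at_one {E : ℂ → M2} {v : ℂ} {Y Y' : ℝ → M2} (hY : IsFrameAlong E v Y)
    (hY' : IsFrameAlong E v Y') {K : ℝ}
    (hK : ∀ s ∈ Icc (0 : ℝ) 1, ∀ i j, ‖v * E (s * v) i j‖ ≤ K) : Y 1 = Y' 1 := by
  let V : ℝ → (Fin 2 → Fin 2 → ℂ) → (Fin 2 → Fin 2 → ℂ) := fun s f i j =>
    f i 0 * (v * E (s * v) 0 j) + f i 1 * (v * E (s * v) 1 j)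
  have hV : ∀ (Z : ℝ → M2), IsFrameAlong E v Z → ∀ s ∈ Icc (0 : ℝ) 1,
      HasDerivWithinAt (fun s => (fun i j => Z s i j : Fin 2 → Fin 2 → ℂ))
        (V s (fun i j => Z s i j)) (Icc 0 1) s := fun Z hZ s hs => by
    refine hasDerivWithinAt_pi.2 fun i => hasDerivWithinAt_pi.2 fun j => ?_
    refine (hZ.2 s hs i j).congr_deriv ?_
    rw [Matrix.smul_apply, Matrix.mul_apply, Fin.sum_univ_two, smul_eq_mul]
    simp only [V]
    ring
  have hI : ∀ (Z : ℝ → M2), IsFrameAlong E v Z → ∀ s ∈ Ico (0 : ℝ) 1,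
      HasDerivWithinAt (fun s => (fun i j => Z s i j : Fin 2 → Fin 2 → ℂ))
        (V s (fun i j => Z s i j)) (Ici s) s := fun Z hZ s hs =>
    (hV Z hZ s (Ico_subset_Icc_self hs)).mono_of_mem_nhdsWithin (Icc_mem_nhdsGE_of_mem hs)
  have hK0 : 0 ≤ K := (norm_nonneg _).trans (hK 0 ⟨le_rfl, zero_le_one⟩ 0 0)
  have h := ODE_solution_unique_of_mem_Icc_right (v := V) (s := fun _ => univ)
    (K := (2 * K).toNNReal) (a := 0) (b := 1) (fun s hs => ?_)
    (fun s hs => (hV Y hY s hs).continuousWithinAt) (hI Y hY) (fun _ _ => mem_univ _)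
    (fun s hs => (hV Y' hY' s hs).continuousWithinAt) (hI Y' hY') (fun _ _ => mem_univ _)
    (by simp only [hY.1, hY'.1])
  · have h1 := h (right_mem_Icc.2 zero_le_one)
    ext i j
    exact congrFun (congrFun h1 i) j
  · refine LipschitzWith.lipschitzOnWith (LipschitzWith.of_dist_le_mul fun f g => ?_)
    rw [Real.coe_toNNReal _ (by positivity), dist_eq_norm, dist_eq_norm]
    refine (pi_norm_le_iff_of_nonneg (by positivity)).2 fun i =>
      (pi_norm_le_iff_of_nonneg (by positivity)).2 fun j => ?_
    have hfg : ∀ l, ‖f i l - g i l‖ ≤ ‖f - g‖ := fun l =>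
      (norm_le_pi_norm ((f - g) i) l).trans (norm_le_pi_norm (f - g) i)
    have hKs := hK s (Ico_subset_Icc_self hs)
    have e : (V s f - V s g) i j =
        (f i 0 - g i 0) * (v * E (s * v) 0 j) + (f i 1 - g i 1) * (v * E (s * v) 1 j) := by
      simp only [V, Pi.sub_apply]
      ring
    rw [e]
    refine (norm_add_le _ _).trans ?_
    rw [norm_mul (f i 0 - g i 0), norm_mul (f i 1 - g i 1)]
    have b0 := mul_le_mul (hfg 0) (hKs 0 j) (norm_nonneg _) (norm_nonneg _)
    have b1 := mul_le_mul (hfg 1) (hKs 1 j) (norm_nonneg _) (norm_nonneg _)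
    have e2 : 2 * K * ‖f - g‖ = ‖f - g‖ * K + ‖f - g‖ * K := by ring
    rw [e2]
    exact add_le_add b0 b1

theorem principal_eq {E : ℂ → M2} {v : ℂ} {Y : ℝ → M2} (hY : IsFrameAlong E v Y) {K : ℝ}
    (hK : ∀ s ∈ Icc (0 : ℝ) 1, ∀ i j, ‖v * E (s * v) i j‖ ≤ K) : principal E v = Y 1 := by
  have h : ∃ Y, IsFrameAlong E v Y := ⟨Y, hY⟩
  rw [principal, dif_pos h]
  exact h.choose_spec.eq_at_one hY hK

/-! ### The principal solution from the Banach algebra -/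

section Frames

open scoped unitInterval ContDiff

variable {ρ : ℝ} [hρ : Fact (1 < ρ)]

/-- Conjugation by `diag(1, d)`. -/
def conjDiag (d : ℂ) (N : M2) : M2 := !![N 0 0, N 0 1 * d⁻¹; d * N 1 0, N 1 1]

/-- Entrywise evaluation. -/
def evMat (z : ℂ) (m : Mat2 (RLoop ρ)) : M2 := Matrix.of fun i j => RLoop.ev z (m i j)

theorem evMat_apply (z : ℂ) (m : Mat2 (RLoop ρ)) (i j : Fin 2) :
    evMat z m i j = RLoop.ev z (m i j) := rfl

variable {α β γ : C(I, ℝ)} {t : ℝ} {a b c : RLoop ρ} {z : ℂ}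

theorem evMat_sysMat (s : I) : evMat z (sysMat α β γ (a, b, c) s) =
    formMat (α s) (β s) (γ s) (RLoop.ev z a) (RLoop.ev z b) (RLoop.ev z c) := by
  ext i j
  rw [evMat_apply, sysMat_apply]
  fin_cases i <;> fin_cases j <;> simp [formMat]

/-- Evaluation at a point of the circle is continuous, linear and multiplicative, so it carries the
equation over `RLoop ρ` to the equation over ℂ. -/
theorem hasDerivAt_evMat_odeFrame (h : Solvable α β γ t (a, b, c)) (hz : ‖z‖ = 1) (s : I)
    (i j : Fin 2) :
    HasDerivAt (fun s => evMat z (odeFrame t (sysMat α β γ (a, b, c)) s) i j)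
      (t * (evMat z (odeFrame t (sysMat α β γ (a, b, c)) s) * formMat (α s) (β s) (γ s)
        (RLoop.ev z a) (RLoop.ev z b) (RLoop.ev z c)) i j) s := by
  have h1 := hasDerivAt_odeFrame h s
  have h2 := ((RLoop.ev z).comp (Mat2.entry (A := RLoop ρ) i j)).hasFDerivAt.comp_hasDerivAt
    (s : ℝ) h1
  refine h2.congr_deriv ?_
  rw [ContinuousLinearMap.comp_apply, Mat2.entry_apply, Mat2.smul_apply, Mat2.mul_apply,
    map_smul, map_add, RLoop.ev_mul hz, RLoop.ev_mul hz, ← evMat_sysMat, Matrix.mul_apply,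
    Fin.sum_univ_two, real_smul]
  rfl

theorem isFrameAlong_odeFrame (h : Solvable α β γ t (a, b, c)) (hz : ‖z‖ = 1) {E : ℂ → M2}
    {v d : ℂ} (hd : d ≠ 0)
    (hE : ∀ s : I, v • E ((s : ℝ) * v) = (t : ℂ) • conjDiag d
      (formMat (α s) (β s) (γ s) (RLoop.ev z a) (RLoop.ev z b) (RLoop.ev z c))) :
    IsFrameAlong E v fun s =>
      conjDiag d (evMat z (odeFrame t (sysMat α β γ (a, b, c)) s)) := by
  constructor
  · beta_reduce
    rw [odeFrame_zero]
    ext i j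
    fin_cases i <;> fin_cases j <;>
      simp [conjDiag, evMat_apply, Mat2.one_apply, RLoop.ev_one hz]
  · intro s hs i j
    have h1 := fun i j => (hasDerivAt_evMat_odeFrame h hz ⟨s, hs⟩ i j).hasDerivWithinAt
      (s := Icc (0 : ℝ) 1)
    rw [← Matrix.mul_smul, hE ⟨s, hs⟩]
    fin_cases i <;> fin_cases j
    · refine (h1 0 0).congr_deriv ?_
      simp [conjDiag, Matrix.mul_apply, Fin.sum_univ_two]
      field_simp
    · refine ((h1 0 1).mul_const d⁻¹).congr_deriv ?_
      simp [conjDiag, Matrix.mul_apply, Fin.sum_univ_two]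
      field_simp
    · refine ((h1 1 0).const_mul d).congr_deriv ?_
      simp [conjDiag, Matrix.mul_apply, Fin.sum_univ_two]
      field_simp
    · refine (h1 1 1).congr_deriv ?_
      simp [conjDiag, Matrix.mul_apply, Fin.sum_univ_two]
      field_simp

theorem principal_eq_conjDiag (h : Solvable α β γ t (a, b, c)) (hz : ‖z‖ = 1) {E : ℂ → M2}
    {v d : ℂ} (hd : d ≠ 0)
    (hE : ∀ s : I, v • E ((s : ℝ) * v) = (t : ℂ) • conjDiag d
      (formMat (α s) (β s) (γ s) (RLoop.ev z a) (RLoop.ev z b) (RLoop.ev z c))) :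
    principal E v = conjDiag d (evMat z (1 + t • odeQuot t (sysMat α β γ (a, b, c)))) := by
  have hb : ∀ i j, ∃ K, ∀ s : I, ‖v * E ((s : ℝ) * v) i j‖ ≤ K := fun i j => by
    have hcont : Continuous fun s : I => v * E ((s : ℝ) * v) i j := by
      have : (fun s : I => v * E ((s : ℝ) * v) i j) = fun s : I => ((t : ℂ) • conjDiag d
          (formMat (α s) (β s) (γ s) (RLoop.ev z a) (RLoop.ev z b) (RLoop.ev z c))) i j := by
        funext s
        rw [← hE s]
        rfl
      rw [this]
      fin_cases i <;> fin_cases j <;> simp [conjDiag, formMat] <;> fun_prop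
    obtain ⟨K, hK⟩ := isCompact_univ.exists_bound_of_continuousOn hcont.continuousOn
    exact ⟨K, fun s => hK s (mem_univ s)⟩
  choose K hK using hb
  rw [← odeFrame_one]
  refine principal_eq (isFrameAlong_odeFrame h hz hd hE) (K := ∑ i, ∑ j, |K i j|)
    fun s hs i j => ?_
  refine (hK i j ⟨s, hs⟩).trans ((le_abs_self _).trans ?_)
  exact (Finset.single_le_sum (f := fun j => |K i j|) (fun _ _ => abs_nonneg _)
    (Finset.mem_univ j)).trans (Finset.single_le_sum (f := fun i => ∑ j, |K i j|)
    (fun _ _ => Finset.sum_nonneg fun _ _ => abs_nonneg _) (Finset.mem_univ i))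

/-- Substituting P = 1 + tZ, the constant terms cancel and one factor t comes out. -/
theorem mul_ev_hatLoop (hz : ‖z‖ = 1) {P : M2}
    (hP : P = evMat z (1 + t • odeQuot t (sysMat α β γ (a, b, c)))) :
    P 0 0 * P 1 0 - P 0 1 * P 1 1 = t * RLoop.ev z (hatLoop α β γ t (a, b, c)) := by
  simp only [hP, evMat_apply, Mat2.add_apply, Mat2.smul_apply, Mat2.one_apply, hatLoop, map_add,
    map_sub, map_smul, RLoop.ev_mul hz, real_smul]
  simp [RLoop.ev_one hz]
  ring

end Frames

end DPW

namespace DPW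

/-! ## The monodromy data as loops in the Banach algebra -/

section MonodromyLoops

open scoped ContDiff

variable {ρ : ℝ} [hρ : Fact (1 < ρ)]

/-- The loop `a`. -/
def loopA (x : Param ρ) : RLoop ρ :=
  (1 / 2 : ℝ) • (RLoop.X (-1) - RLoop.X 1) + incl x.1
/-- The loop `b`. -/
def loopB (φ : ℝ) (x : Param ρ) : RLoop ρ :=
  (-(1 / 2) * Real.sin φ) • (RLoop.X (-1) + RLoop.X 1) + incl x.2.1
/-- The loop `c`. -/
def loopC (φ : ℝ) (x : Param ρ) : RLoop ρ :=
  (-(1 / 2) * Real.cos φ) • (RLoop.X (-1) + RLoop.X 1) + incl x.2.2.1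

section Evaluation

variable {z : ℂ} (φ : ℝ) (x : Param ρ)

theorem ev_loopA (hz : ‖z‖ = 1) : RLoop.ev z (loopA x) = x.a z := by
  simp [loopA, Param.a, RLoop.ev_X hz, ev_incl hz, real_smul]

theorem ev_loopB (hz : ‖z‖ = 1) : RLoop.ev z (loopB φ x) = x.b φ z := by
  simp [loopB, Param.b, RLoop.ev_X hz, ev_incl hz, real_smul, -ofReal_sin]
  ring

theorem ev_loopC (hz : ‖z‖ = 1) : RLoop.ev z (loopC φ x) = x.c φ z := by
  simp [loopC, Param.c, RLoop.ev_X hz, ev_incl hz, real_smul, -ofReal_cos]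
  ring

end Evaluation

/-- The coefficients of the system along the segment from `0` to `1`. -/
def parP (φ : ℝ) (x : Param ρ) : RLoop ρ × RLoop ρ × RLoop ρ :=
  (x.r • loopA x, x.r • loopB φ x, x.r • loopC φ x)

/-- The coefficients of the system along the segment from `0` to `i`. -/
def parQ (φ : ℝ) (x : Param ρ) : RLoop ρ × RLoop ρ × RLoop ρ :=
  (-(x.r • loopA x), x.r • loopC φ x, x.r • loopB φ x)

variable {φ : ℝ}

theorem ofReal_notMem_range_punct (h : Real.sin φ ≠ 0) (s : ℝ) :
    (s : ℂ) ∉ range (punct φ) := by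
  rw [mem_range_punct, ← ofReal_segPoly]
  exact ofReal_ne_zero.2 (segPoly_pos h s).ne'

theorem mul_I_notMem_range_punct (h : Real.sin (Real.pi / 2 - φ) ≠ 0) (s : ℝ) :
    (s : ℂ) * I ∉ range (punct φ) := by
  rw [mem_range_punct, ← ofReal_segPoly_compl]
  exact ofReal_ne_zero.2 (segPoly_pos h s).ne'

variable {t : ℝ} {x : Param ρ} {z : ℂ}

theorem pFun_eq_mul_ev (h : Real.sin φ ≠ 0)
    (hs : Solvable (segA φ h) (segB φ h) (segC φ h) t (parP φ x)) (hz : ‖z‖ = 1) :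
    pFun φ t x z =
      t * RLoop.ev z (hatLoop (segA φ h) (segB φ h) (segC φ h) t (parP φ x)) := by
  have h1 := principal_eq_conjDiag (E := potential φ t x z) (v := 1) hs hz one_ne_zero fun s => by
    rw [mul_one, potential_eq φ t x z (ofReal_notMem_range_punct h s), ← ofReal_segA φ h,
      ← ofReal_segB φ h, ← ofReal_segC φ h]
    ext i j
    fin_cases i <;> fin_cases j <;>
      simp [conjDiag, formMat, ev_loopA x hz, ev_loopB φ x hz, ev_loopC φ x hz] <;> ring
  refine mul_ev_hatLoop hz ?_
  rw [h1]
  ext i j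
  fin_cases i <;> fin_cases j <;> simp [conjDiag]

/-- The factor i and the plus sign in the definition of 𝔮 are undone by the gauge diag(1, -i), which
leaves the expression defining 𝔭. -/
theorem conjDiag_neg_I (N : M2) :
    I * (conjDiag (-I) N 0 0 * conjDiag (-I) N 1 0 + conjDiag (-I) N 0 1 * conjDiag (-I) N 1 1) =
      N 0 0 * N 1 0 - N 0 1 * N 1 1 := by
  simp [conjDiag]
  linear_combination (-(N 0 0 * N 1 0) + N 0 1 * N 1 1) * I_sq

theorem qFun_eq_mul_ev (h : Real.sin (Real.pi / 2 - φ) ≠ 0)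
    (hs : Solvable (segA (Real.pi / 2 - φ) h) (segB (Real.pi / 2 - φ) h)
      (segC (Real.pi / 2 - φ) h) t (parQ φ x)) (hz : ‖z‖ = 1) :
    qFun φ t x z = t * RLoop.ev z (hatLoop (segA (Real.pi / 2 - φ) h) (segB (Real.pi / 2 - φ) h)
      (segC (Real.pi / 2 - φ) h) t (parQ φ x)) := by
  have h1 := principal_eq_conjDiag (E := potential φ t x z) (v := I) hs hz
    (neg_ne_zero.2 I_ne_zero) fun s => by
    rw [potential_eq φ t x z (mul_I_notMem_range_punct h s), coefA_mul_I φ h,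
      coefB_mul_I φ h, coefC_mul_I φ h]
    ext i j
    fin_cases i <;> fin_cases j <;>
      simp [conjDiag, formMat, ev_loopA x hz, ev_loopB φ x hz, ev_loopC φ x hz]
    · linear_combination (x.r * t * segA (Real.pi / 2 - φ) h s * x.a z : ℂ) * I_sq
    · ring
    · ring
    · linear_combination (-(x.r * t * segA (Real.pi / 2 - φ) h s * x.a z) : ℂ) * I_sq
  refine Eq.trans ?_ (mul_ev_hatLoop hz rfl)
  rw [qFun, h1]
  exact conjDiag_neg_I _

/-- The factorization is required only near 0, for the derivative, and at t itself, for the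
quotient; it may fail in between, where solvability is not known. -/
theorem dslope_eq_of_eventually {f g : ℝ → ℂ} (h0 : ∀ᶠ s in 𝓝 (0 : ℝ), f s = s * g s)
    (ht : f t = t * g t) (hg : ContinuousAt g 0) : dslope f 0 t = g t := by
  have hf0 : f 0 = 0 := by simpa using h0.self_of_nhds
  rcases eq_or_ne t 0 with rfl | ht0
  · rw [dslope_same]
    refine HasDerivAt.deriv (hasDerivAt_iff_tendsto_slope.2 ?_)
    refine (hg.tendsto.mono_left nhdsWithin_le_nhds).congr' ?_
    filter_upwards [h0.filter_mono nhdsWithin_le_nhds, self_mem_nhdsWithin] with s hs hs0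
    have : (s : ℂ) ≠ 0 := ofReal_ne_zero.2 hs0
    rw [slope_def_module, hf0, sub_zero, sub_zero, hs, real_smul, ofReal_inv,
      inv_mul_cancel_left₀ this]
  · have : (t : ℂ) ≠ 0 := ofReal_ne_zero.2 ht0
    rw [dslope_of_ne _ ht0, slope_def_module, hf0, sub_zero, sub_zero, ht, real_smul, ofReal_inv,
      inv_mul_cancel_left₀ this]

theorem dslope_eq_ev_hatLoop {α β γ : C(Icc (0 : ℝ) 1, ℝ)} {w : RLoop ρ × RLoop ρ × RLoop ρ}
    {f : ℝ → ℂ} (hf : ∀ s : ℝ, Solvable α β γ s w → f s = s * RLoop.ev z (hatLoop α β γ s w))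
    (ht : Solvable α β γ t w) : dslope f 0 t = RLoop.ev z (hatLoop α β γ t w) := by
  have hc : Continuous fun s : ℝ => (s, w) := by fun_prop
  refine dslope_eq_of_eventually (g := fun s : ℝ => (RLoop.ev z (hatLoop α β γ s w) : ℂ)) ?_
    (hf t ht) ?_
  · have h1 : ∀ᶠ s in 𝓝 (0 : ℝ), Solvable α β γ s w :=
      ((isOpen_solvable α β γ).preimage hc).mem_nhds (solvable_zero α β γ w)
    exact h1.mono hf
  · exact (RLoop.ev (ρ := ρ) z).continuous.continuousAt.comp
      ((contDiffAt_hatLoop (solvable_zero α β γ w)).continuousAt.comp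
        (f := fun s : ℝ => (s, w)) hc.continuousAt)

theorem pHat_eq_ev (h : Real.sin φ ≠ 0)
    (hs : Solvable (segA φ h) (segB φ h) (segC φ h) t (parP φ x)) (hz : ‖z‖ = 1) :
    pHat φ t x z = RLoop.ev z (hatLoop (segA φ h) (segB φ h) (segC φ h) t (parP φ x)) :=
  dslope_eq_ev_hatLoop (fun _ h1 => pFun_eq_mul_ev h h1 hz) hs

theorem qHat_eq_ev (h : Real.sin (Real.pi / 2 - φ) ≠ 0)
    (hs : Solvable (segA (Real.pi / 2 - φ) h) (segB (Real.pi / 2 - φ) h)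
      (segC (Real.pi / 2 - φ) h) t (parQ φ x)) (hz : ‖z‖ = 1) :
    qHat φ t x z = RLoop.ev z (hatLoop (segA (Real.pi / 2 - φ) h) (segB (Real.pi / 2 - φ) h)
      (segC (Real.pi / 2 - φ) h) t (parQ φ x)) :=
  dslope_eq_ev_hatLoop (fun _ h1 => qFun_eq_mul_ev h h1 hz) hs

end MonodromyLoops

end DPW

namespace DPW

/-! ## The monodromy problem as an equation between Banach spaces -/

section MonodromyMap

open scoped ContDiff

variable {ρ : ℝ} [hρ : Fact (1 < ρ)]

theorem summable_coeff_neg (f : RLoop ρ) : Summable fun k => |f.coeff (-k)| * wt ρ k :=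
  ((Equiv.neg ℤ).summable_iff.2 f.summable_coeff).congr fun k => by simp [wt]

/-- The substitution `λ ↦ λ⁻¹` on loops. -/
def revLoop : RLoop ρ →L[ℝ] RLoop ρ :=
  LinearMap.mkContinuous
    { toFun := fun f => RLoop.mk (fun k => f.coeff (-k)) (summable_coeff_neg f)
      map_add' := fun f g => RLoop.ext fun k => by simp
      map_smul' := fun r f => RLoop.ext fun k => by simp } 1 fun f => by
    rw [one_mul, RLoop.norm_eq, RLoop.norm_eq, ← (Equiv.neg ℤ).tsum_eq]
    simp [wt]

@[simp] theorem coeff_revLoop (f : RLoop ρ) (k : ℤ) : (revLoop f).coeff k = f.coeff (-k) :=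
  RLoop.coeff_mk _ (summable_coeff_neg f) k

/-- The antisymmetric part of a loop, as a nonnegative loop. -/
def skewPart : RLoop ρ →L[ℝ] WRNonneg ρ :=
  trunc ∘L ContinuousLinearMap.mul ℝ (RLoop ρ) (RLoop.X (-1)) ∘L
    (ContinuousLinearMap.id ℝ (RLoop ρ) - revLoop)

theorem skewPart_apply (f : RLoop ρ) :
    skewPart f = trunc (RLoop.X (-1) * (f - revLoop f)) := rfl

/-- The difference of f and its reversal is antisymmetric, so its positive coefficients determine
it. The factor λ⁻¹ drops the constant coefficient, which is always 0 and would obstruct surjectivity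
of the linearization. -/
theorem skewPart_eq_zero_iff (f : RLoop ρ) :
    skewPart f = 0 ↔ ∀ k, f.coeff k = f.coeff (-k) := by
  rw [skewPart_apply, trunc_eq_zero_iff]
  simp only [RLoop.coeff_X_mul, RLoop.coeff_sub, coeff_revLoop, sub_eq_zero]
  refine ⟨fun h k => ?_, fun h k _ => h _⟩
  rcases lt_trichotomy k 0 with hk | rfl | hk
  · have := h (-k - 1) (by omega)
    rw [show -k - 1 - -1 = -k by ring, neg_neg] at this
    exact this.symm
  · simp
  · have := h (k - 1) (by omega)
    rwa [show k - 1 - -1 = k by ring] at this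

theorem skewPart_incl (h : WRNonneg ρ) : skewPart (incl h) = leftShift 1 h := by
  refine incl.injective (RLoop.ext fun k => ?_)
  rw [skewPart_apply, coeff_incl_trunc, coeff_incl_leftShift]
  split_ifs with hk
  · rw [RLoop.coeff_X_mul, RLoop.coeff_sub, coeff_revLoop,
      coeff_incl_of_neg h (k := -(k - -1)) (by omega), sub_zero, sub_neg_eq_add]
    rfl
  · rfl

/-- The loop `λ (𝒦 + 1)`. -/
def detLoop (φ : ℝ) (x : Param ρ) : RLoop ρ :=
  (1 - x.r ^ 2) • RLoop.X 1 + x.r ^ 2 • ((1 - RLoop.X 2) * incl x.1 +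
    (1 + RLoop.X 2) * (Real.sin φ • incl x.2.1 + Real.cos φ • incl x.2.2.1) +
    RLoop.X 1 * (incl x.1 * incl x.1 - incl x.2.1 * incl x.2.1 - incl x.2.2.1 * incl x.2.2.1))

/-- The determinant is r²(a² - b² - c²), and the principal parts alone contribute ((λ⁻¹ - λ)² - (λ⁻¹
+ λ)²)/4 = -1. After multiplication by λ no negative power remains. -/
theorem ev_detLoop {z : ℂ} (hz : ‖z‖ = 1) (φ : ℝ) (x : Param ρ) :
    RLoop.ev z (detLoop φ x) = z * (calK φ x z + 1) := by
  have hz0 : z ≠ 0 := by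
    rintro rfl
    simp at hz
  have hsc : (Real.sin φ : ℂ) ^ 2 + (Real.cos φ : ℂ) ^ 2 = 1 := by
    exact_mod_cast Real.sin_sq_add_cos_sq φ
  rw [calK, Matrix.det_fin_two]
  simp only [detLoop, map_add, map_sub, map_smul, RLoop.ev_mul hz, RLoop.ev_X hz, RLoop.ev_one hz,
    ev_incl hz, real_smul, residue, Param.a, Param.b, Param.c, Matrix.smul_apply]
  simp [-ofReal_sin, -ofReal_cos]
  generalize (Real.sin φ : ℂ) = sn at *
  generalize (Real.cos φ : ℂ) = cs at *
  generalize loopEval x.1 z = a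
  generalize loopEval x.2.1 z = b
  generalize loopEval x.2.2.1 z = c
  generalize (x.r : ℂ) = r
  have hI := I_sq
  field_simp
  ring_nf
  simp only [hI]
  linear_combination r ^ 2 * (z ^ 2 + 1) ^ 2 * hsc

theorem coeff_X_of_neg {n k : ℤ} (hn : 0 ≤ n) (hk : k < 0) : (RLoop.X n : RLoop ρ).coeff k = 0 := by
  rw [RLoop.coeff_X, Pi.single_eq_of_ne (by omega)]

theorem coeff_one_of_neg {k : ℤ} (hk : k < 0) : (1 : RLoop ρ).coeff k = 0 :=
  coeff_X_of_neg le_rfl hk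

theorem coeff_detLoop_of_neg (φ : ℝ) (x : Param ρ) {k : ℤ} (hk : k < 0) :
    (detLoop φ x).coeff k = 0 := by
  have hi := fun (h : WRNonneg ρ) k (hk : k < 0) => coeff_incl_of_neg h hk
  have h1 : ∀ k < 0, ((1 - RLoop.X 2) * incl x.1 : RLoop ρ).coeff k = 0 := fun k hk =>
    RLoop.coeff_mul_of_neg (fun j hj => by
      rw [RLoop.coeff_sub, coeff_one_of_neg hj, coeff_X_of_neg zero_le_two hj, sub_zero])
      (hi _) hk
  have h2 : ∀ k < 0, ((1 + RLoop.X 2) * (Real.sin φ • incl x.2.1 + Real.cos φ • incl x.2.2.1) :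
      RLoop ρ).coeff k = 0 := fun k hk =>
    RLoop.coeff_mul_of_neg (fun j hj => by
      rw [RLoop.coeff_add, coeff_one_of_neg hj, coeff_X_of_neg zero_le_two hj, add_zero])
      (fun j hj => by simp [hi _ j hj, -coeff_incl]) hk
  have h4 : ∀ (h : WRNonneg ρ), ∀ k < 0, (incl h * incl h).coeff k = 0 := fun h k hk =>
    RLoop.coeff_mul_of_neg (hi h) (hi h) hk
  have h3 : ∀ k < 0, (RLoop.X 1 * (incl x.1 * incl x.1 - incl x.2.1 * incl x.2.1 -
      incl x.2.2.1 * incl x.2.2.1) : RLoop ρ).coeff k = 0 := fun k hk =>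
    RLoop.coeff_mul_of_neg (fun j hj => coeff_X_of_neg zero_le_one hj)
      (fun j hj => by simp [h4 _ j hj]) hk
  rw [detLoop, RLoop.coeff_add, RLoop.coeff_smul, RLoop.coeff_smul, RLoop.coeff_add,
    RLoop.coeff_add, h1 k hk, h2 k hk, h3 k hk, coeff_X_of_neg zero_le_one hk]
  ring

theorem trunc_detLoop_eq_zero_iff (φ : ℝ) (x : Param ρ) :
    trunc (detLoop φ x) = 0 ↔ ∀ z ∈ Metric.sphere (0 : ℂ) 1, calK φ x z = -1 := by
  have h0 : trunc (detLoop φ x) = 0 ↔ detLoop φ x = 0 := by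
    refine ⟨fun h => ?_, fun h => by rw [h, map_zero]⟩
    rw [← incl_trunc_eq fun k hk => coeff_detLoop_of_neg φ x hk, h, map_zero]
  rw [h0]
  have hz0 : ∀ z : ℂ, ‖z‖ = 1 → z ≠ 0 := fun z hz => by
    rintro rfl
    simp at hz
  constructor
  · intro h z hz
    rw [mem_sphere_zero_iff_norm] at hz
    have h1 := ev_detLoop hz φ x
    rw [h, map_zero, eq_comm, mul_eq_zero] at h1
    exact eq_neg_of_add_eq_zero_left (h1.resolve_left (hz0 z hz))
  · intro h
    refine RLoop.ext_of_ev fun z hz => ?_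
    rw [ev_detLoop hz, h z (mem_sphere_zero_iff_norm.2 hz), neg_add_cancel, mul_zero, map_zero]

theorem norm_exp_I_mul (θ : ℝ) : ‖exp (I * θ)‖ = 1 := by
  rw [mul_comm]
  exact norm_exp_ofReal_mul_I θ

section

variable (φ : ℝ) (hP : Real.sin φ ≠ 0) (hQ : Real.sin (Real.pi / 2 - φ) ≠ 0)

/-- The loop `\hat 𝔭`. -/
def pLoop (q : ℝ × Param ρ) : RLoop ρ :=
  hatLoop (segA φ hP) (segB φ hP) (segC φ hP) q.1 (parP φ q.2)

/-- The loop `\hat 𝔮`. -/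
def qLoop (q : ℝ × Param ρ) : RLoop ρ :=
  hatLoop (segA (Real.pi / 2 - φ) hQ) (segB (Real.pi / 2 - φ) hQ) (segC (Real.pi / 2 - φ) hQ)
    q.1 (parQ φ q.2)

/-- Both systems are solved by their Neumann series. -/
def FramesSolvable (q : ℝ × Param ρ) : Prop :=
  Solvable (segA φ hP) (segB φ hP) (segC φ hP) q.1 (parP φ q.2) ∧
  Solvable (segA (Real.pi / 2 - φ) hQ) (segB (Real.pi / 2 - φ) hQ) (segC (Real.pi / 2 - φ) hQ)
    q.1 (parQ φ q.2)

/-- The map whose zeros are the solutions of the monodromy problem. -/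
def monodromyMap (q : ℝ × Param ρ) : Param ρ :=
  (skewPart (pLoop φ hP q), skewPart (qLoop φ hQ q), trunc (detLoop φ q.2),
    (RLoop.ev (exp (I * q.2.θ)) (pLoop φ hP q)).re, (RLoop.ev (exp (I * q.2.θ)) (qLoop φ hQ q)).re)

variable {φ}

theorem sub_starLoop_eq_zero_iff {F : ℂ → ℂ} {f : RLoop ρ}
    (hF : ∀ z : ℂ, ‖z‖ = 1 → F z = RLoop.ev z f) :
    (∀ z ∈ Metric.sphere (0 : ℂ) 1, F z - starLoop F z = 0) ↔ skewPart f = 0 := by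
  rw [skewPart_eq_zero_iff, ← RLoop.ev_real_iff]
  refine forall_congr' fun z => ?_
  rw [mem_sphere_zero_iff_norm]
  refine forall_congr' fun hz => ?_
  have h1 : 1 / conj z = z := by
    rw [one_div, ← inv_eq_conj hz, inv_inv]
  rw [starLoop, h1, hF z hz, sub_eq_zero]

/-- Once the skew parts vanish, the two loops are real on the circle, so the real parts taken in
`monodromyMap` lose nothing of the last two equations. -/
theorem solvesMonodromyProblem_iff {t : ℝ} {x : Param ρ} (h : FramesSolvable φ hP hQ (t, x)) :
    SolvesMonodromyProblem φ t x ↔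
      x.θ ∈ Ioo 0 Real.pi ∧ monodromyMap φ hP hQ (t, x) = 0 := by
  have hp : ∀ z : ℂ, ‖z‖ = 1 → pHat φ t x z = RLoop.ev z (pLoop φ hP (t, x)) := fun z hz =>
    pHat_eq_ev hP h.1 hz
  have hq : ∀ z : ℂ, ‖z‖ = 1 → qHat φ t x z = RLoop.ev z (qLoop φ hQ (t, x)) := fun z hz =>
    qHat_eq_ev hQ h.2 hz
  have hF := sub_starLoop_eq_zero_iff hp
  have hG := sub_starLoop_eq_zero_iff hq
  have hK := trunc_detLoop_eq_zero_iff φ x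
  have hre : ∀ f : RLoop ρ, skewPart f = 0 →
      (RLoop.ev (exp (I * x.θ)) f = 0 ↔ (RLoop.ev (exp (I * x.θ)) f).re = 0) := fun f hf => by
    rw [skewPart_eq_zero_iff, ← RLoop.ev_real_iff] at hf
    have := hf _ (norm_exp_I_mul x.θ)
    refine ⟨fun h => by rw [h, zero_re], fun h => ?_⟩
    rw [← conj_eq_iff_re.1 this.symm, h, ofReal_zero]
  rw [monodromyMap]
  simp only [Prod.mk_eq_zero]
  constructor
  · intro hs
    have h1 := hF.1 hs.F_eq
    have h2 := hG.1 hs.G_eq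
    refine ⟨hs.θ_mem, h1, h2, hK.2 hs.K_eq, (hre _ h1).1 ?_, (hre _ h2).1 ?_⟩
    · rw [← hp _ (norm_exp_I_mul _)]
      exact hs.H₁_eq
    · rw [← hq _ (norm_exp_I_mul _)]
      exact hs.H₂_eq
  · rintro ⟨h0, h1, h2, h3, h4, h5⟩
    exact ⟨hF.2 h1, hG.2 h2, hK.1 h3, h0, (hp _ (norm_exp_I_mul _)).trans ((hre _ h1).2 h4),
      (hq _ (norm_exp_I_mul _)).trans ((hre _ h2).2 h5)⟩

end

end MonodromyMap

end DPW

namespace DPW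

/-! ## The linearization at the central value -/

section Linearization

open scoped ContDiff

variable {ρ : ℝ} [hρ : Fact (1 < ρ)]

/-- The loop `(1 - λ²) ã + (1 + λ²) (sin φ b̃ + cos φ c̃) - 2 r λ`. -/
def detLoopLin (φ : ℝ) (h : Param ρ) : RLoop ρ :=
  (1 - RLoop.X 2) * incl h.1 + (1 + RLoop.X 2) * (Real.sin φ • incl h.2.1 +
    Real.cos φ • incl h.2.2.1) - (2 * h.r) • RLoop.X 1

/-- The derivative of `monodromyMap` at the central value. -/
def monodromyLin (φ : ℝ) (h : Param ρ) : Param ρ :=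
  ((2 * Real.pi) • leftShift 1 h.2.2.1, (2 * Real.pi) • leftShift 1 h.2.1,
    trunc (detLoopLin φ h),
    2 * Real.pi * (Real.cos φ * h.θ + (RLoop.ev I (incl h.2.2.1)).re),
    2 * Real.pi * (Real.sin φ * h.θ + (RLoop.ev I (incl h.2.1)).re))

/-! ### Bijectivity -/

theorem incl_eq_smul_one_of_leftShift_eq_zero {h : WRNonneg ρ} (hh : leftShift 1 h = 0) :
    ∃ k : ℝ, incl h = k • (1 : RLoop ρ) := by
  refine ⟨(incl h).coeff 0, RLoop.ext fun k => ?_⟩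
  rw [RLoop.coeff_smul, RLoop.one_def, RLoop.coeff_X]
  rcases lt_trichotomy k 0 with hk | rfl | hk
  · rw [coeff_incl_of_neg h hk, Pi.single_eq_of_ne hk.ne, mul_zero]
  · simp
  · have h1 := coeff_incl_leftShift 1 h (k - 1)
    rw [hh, map_zero, RLoop.coeff_zero, if_pos (by omega)] at h1
    rw [Pi.single_eq_of_ne hk.ne', mul_zero, h1]
    congr 1
    push_cast
    ring

theorem coeff_detLoopLin_of_neg (φ : ℝ) (h : Param ρ) {k : ℤ} (hk : k < 0) :
    (detLoopLin φ h).coeff k = 0 := by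
  have hi := fun (h : WRNonneg ρ) k (hk : k < 0) => coeff_incl_of_neg h hk
  have h1 : ∀ k < 0, ((1 - RLoop.X 2) * incl h.1 : RLoop ρ).coeff k = 0 := fun k hk =>
    RLoop.coeff_mul_of_neg (fun j hj => by
      rw [RLoop.coeff_sub, coeff_one_of_neg hj, coeff_X_of_neg zero_le_two hj, sub_zero])
      (hi _) hk
  have h2 : ∀ k < 0, ((1 + RLoop.X 2) * (Real.sin φ • incl h.2.1 + Real.cos φ • incl h.2.2.1) :
      RLoop ρ).coeff k = 0 := fun k hk =>
    RLoop.coeff_mul_of_neg (fun j hj => by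
      rw [RLoop.coeff_add, coeff_one_of_neg hj, coeff_X_of_neg zero_le_two hj, add_zero])
      (fun j hj => by simp [hi _ j hj, -coeff_incl]) hk
  rw [detLoopLin, RLoop.coeff_sub, RLoop.coeff_add, RLoop.coeff_smul, h1 k hk, h2 k hk,
    coeff_X_of_neg zero_le_one hk]
  ring

/-- The constant loop. -/
def constLoop (k : ℝ) : WRNonneg ρ := trunc (k • 1)

theorem incl_constLoop (k : ℝ) : incl (constLoop k : WRNonneg ρ) = k • 1 :=
  incl_trunc_eq fun j hj => by rw [RLoop.coeff_smul, coeff_one_of_neg hj, mul_zero]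

/-- The multiplication by `λ`. -/
def rightShift (h : WRNonneg ρ) : WRNonneg ρ := trunc (RLoop.X 1 * incl h)

theorem incl_rightShift (h : WRNonneg ρ) : incl (rightShift h) = RLoop.X 1 * incl h :=
  incl_trunc_eq fun j hj => by
    rw [RLoop.coeff_X_mul, coeff_incl_of_neg h (by omega)]

theorem leftShift_constLoop (k : ℝ) : leftShift 1 (constLoop k : WRNonneg ρ) = 0 := by
  refine incl.injective (RLoop.ext fun j => ?_)
  rw [coeff_incl_leftShift, incl_constLoop, map_zero, RLoop.coeff_zero]
  split_ifs with hj
  · rw [RLoop.coeff_smul, RLoop.one_def, RLoop.coeff_X, Pi.single_eq_of_ne (by push_cast; omega),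
      mul_zero]
  · rfl

theorem leftShift_rightShift (h : WRNonneg ρ) : leftShift 1 (rightShift h) = h := by
  refine incl.injective (RLoop.ext fun j => ?_)
  rw [coeff_incl_leftShift, incl_rightShift]
  split_ifs with hj
  · rw [RLoop.coeff_X_mul]
    congr 1
    push_cast
    ring
  · rw [coeff_incl_of_neg h (by omega)]

theorem monodromyLin_injective {φ : ℝ} {h : Param ρ} (hh : monodromyLin φ h = 0) : h = 0 := by
  obtain ⟨a, b, c, r, θ⟩ := h
  simp only [monodromyLin, Prod.mk_eq_zero, smul_eq_zero, mul_eq_zero, Real.pi_ne_zero,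
    two_ne_zero, false_or] at hh
  obtain ⟨h1, h2, h3, h4, h5⟩ := hh
  obtain ⟨γ, hγ⟩ := incl_eq_smul_one_of_leftShift_eq_zero h1
  obtain ⟨β, hβ⟩ := incl_eq_smul_one_of_leftShift_eq_zero h2
  have hI1 : ‖I‖ = 1 := norm_I
  simp only [hγ, hβ, map_smul, RLoop.ev_one hI1, Complex.real_smul, mul_one, ofReal_re,
    Param.θ] at h4 h5
  have h6 : detLoopLin φ (a, b, c, r, θ) = 0 := by
    rw [← incl_trunc_eq fun k hk => coeff_detLoopLin_of_neg φ (a, b, c, r, θ) hk, h3, map_zero]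
  set k := Real.sin φ * β + Real.cos φ * γ with hk
  -- Rewriting (1 + λ²)k as 2k - (1 - λ²)k gives a division with zero dividend and remainder -2k +
  -- 2rλ.
  have h7 : (1 - RLoop.X 2) * incl (a - constLoop k) =
      (-(2 * k)) • (1 : RLoop ρ) + (2 * r) • RLoop.X 1 := by
    simp only [detLoopLin, hγ, hβ, Param.r] at h6
    rw [map_sub, incl_constLoop]
    rw [smul_smul, smul_smul, ← add_smul, ← hk, sub_eq_zero] at h6
    rw [← h6]
    simp only [Algebra.smul_def, map_neg, map_mul, map_ofNat, mul_one]
    ring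
  obtain ⟨h8, h9, h10⟩ := div_one_sub_sq_unique h7
  have hk0 : k = 0 := by linarith
  have hr0 : r = 0 := by linarith
  have ha : a = 0 := by
    rw [sub_eq_zero] at h8
    rw [h8, hk0, constLoop, zero_smul, map_zero]
  -- Weighting the last two equations with cos φ and sin φ gives θ + k = 0, and k is already known
  -- to be 0.
  have hθ : θ = 0 := by
    have := Real.sin_sq_add_cos_sq φ
    linear_combination Real.cos φ * h4 + Real.sin φ * h5 - θ * this + hk - hk0
  have hγ0 : γ = 0 := by
    rw [hθ] at h4
    linarith
  have hβ0 : β = 0 := by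
    rw [hθ] at h5
    linarith
  have hc : c = 0 := incl.injective (by rw [hγ, hγ0, zero_smul, map_zero])
  have hb : b = 0 := incl.injective (by rw [hβ, hβ0, zero_smul, map_zero])
  rw [ha, hb, hc, hr0, hθ]
  rfl

theorem monodromyLin_surjective (φ : ℝ) : Function.Surjective (monodromyLin φ : Param ρ → _) := by
  rintro ⟨F, G, K, p, q⟩
  have hpi : 2 * Real.pi ≠ 0 := by positivity
  have hsc := Real.sin_sq_add_cos_sq φ
  set c₁ : WRNonneg ρ := rightShift ((2 * Real.pi)⁻¹ • F) with hc₁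
  set b₁ : WRNonneg ρ := rightShift ((2 * Real.pi)⁻¹ • G) with hb₁
  let M : WRNonneg ρ := Real.sin φ • b₁ + Real.cos φ • c₁
  -- With b̃ and c̃ fixed up to constants, what remains of the K equation is K - (1 + λ²)M. The
  -- remainder β'λ is absorbed by r, and α by the constants.
  obtain ⟨g, α, β', hg⟩ := exists_div_one_sub_sq (K - M - rightShift (rightShift M))
  set u := (RLoop.ev I (incl c₁)).re with hu
  set w := (RLoop.ev I (incl b₁)).re with hw
  -- The last two equations express β and γ through θ; this θ makes sin φ β + cos φ γ = -α/2, the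
  -- constant that cancels α in the K equation once ã is shifted by -α/2.
  let θ : ℝ := Real.sin φ * (q * (2 * Real.pi)⁻¹ - w) + Real.cos φ * (p * (2 * Real.pi)⁻¹ - u) +
    α / 2
  let γ : ℝ := p * (2 * Real.pi)⁻¹ - u - Real.cos φ * θ
  let β : ℝ := q * (2 * Real.pi)⁻¹ - w - Real.sin φ * θ
  have hk : Real.sin φ * β + Real.cos φ * γ = -(α / 2) := by
    simp only [β, γ]
    linear_combination (-θ) * hsc
  have hI1 : ‖I‖ = 1 := norm_I
  refine ⟨(g + constLoop (-(α / 2)), b₁ + constLoop β, c₁ + constLoop γ, β' / 2, θ), ?_⟩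
  simp only [monodromyLin, Prod.mk.injEq]
  refine ⟨?_, ?_, ?_, ?_, ?_⟩
  · rw [map_add, leftShift_constLoop, add_zero, hc₁, leftShift_rightShift, smul_smul,
      mul_inv_cancel₀ hpi, one_smul]
  · rw [map_add, leftShift_constLoop, add_zero, hb₁, leftShift_rightShift, smul_smul,
      mul_inv_cancel₀ hpi, one_smul]
  · rw [← trunc_incl K]
    congr 1
    have hXX : (RLoop.X 1 * RLoop.X 1 : RLoop ρ) = RLoop.X 2 := RLoop.X_mul_X 1 1
    simp only [map_sub, incl_rightShift, M, map_add, map_smul, ← mul_assoc, hXX] at hg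
    simp only [detLoopLin, Param.r, map_add, incl_constLoop]
    have hk' := congrArg (algebraMap ℝ (RLoop ρ)) hk
    have h2 : ∀ s : ℝ, algebraMap ℝ (RLoop ρ) s = 2 * algebraMap ℝ (RLoop ρ) (s / 2) := fun s => by
      rw [← map_ofNat (algebraMap ℝ (RLoop ρ)) 2, ← map_mul, mul_div_cancel₀ s two_ne_zero]
    simp only [map_add, map_mul, map_neg] at hk'
    simp only [Algebra.smul_def, mul_one, map_mul, map_neg, map_ofNat] at hg ⊢
    linear_combination hg + (1 + RLoop.X 2) * hk' + h2 α + RLoop.X 1 * h2 β'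
  · simp only [Param.θ, map_add, incl_constLoop, map_smul, RLoop.ev_one hI1, add_re, ← hu,
      Complex.real_smul, mul_one, ofReal_re, γ]
    field_simp
    ring
  · simp only [Param.θ, map_add, incl_constLoop, map_smul, RLoop.ev_one hI1, add_re, ← hw,
      Complex.real_smul, mul_one, ofReal_re, β]
    field_simp
    ring

end Linearization

end DPW

namespace DPW

/-! ## The derivative at the central value and the implicit function -/

section Implicit

open scoped ContDiff

variable {ρ : ℝ} [hρ : Fact (1 < ρ)]

section Line

variable (k r θ : ℝ) (g : WRNonneg ρ)

/-- The first-order variation of the two monodromy loops at `t = 0`. -/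
def lineLoop (s : ℝ) : RLoop ρ :=
  (2 * Real.pi * (1 + s * r)) •
    ((-(1 / 2) * k) • (RLoop.X (-1) + RLoop.X 1) + s • incl g)

theorem skewPart_X_add_X : skewPart (RLoop.X (-1) + RLoop.X 1 : RLoop ρ) = 0 := by
  rw [skewPart_eq_zero_iff]
  intro j
  simp only [RLoop.coeff_add, RLoop.coeff_X, Pi.single_apply]
  rw [add_comm]
  congr 2 <;> simp [neg_eq_iff_eq_neg]

theorem skewPart_lineLoop (s : ℝ) :
    skewPart (lineLoop k r g s) = (2 * Real.pi * (1 + s * r) * s) • leftShift 1 g := by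
  rw [lineLoop, map_smul, map_add, map_smul, skewPart_X_add_X, smul_zero, zero_add, map_smul,
    skewPart_incl, smul_smul]

theorem hasDerivAt_skewPart_lineLoop :
    HasDerivAt (fun s => skewPart (lineLoop k r g s)) ((2 * Real.pi) • leftShift 1 g) 0 := by
  simp only [skewPart_lineLoop]
  have h1 : HasDerivAt (fun s : ℝ => 2 * Real.pi * (1 + s * r) * s) (2 * Real.pi) 0 := by
    have := ((((hasDerivAt_id (0 : ℝ)).mul_const r).const_add 1).const_mul (2 * Real.pi)).mul
      (hasDerivAt_id (0 : ℝ))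
    refine this.congr_deriv ?_
    simp
  exact h1.smul_const (leftShift 1 g)

/-- A fixed loop is analytic on the circle, but here loop and point vary together; this works
because evaluation is analytic as a map into the dual space. -/
theorem contDiffAt_ev_exp {E : Type*} [NormedAddCommGroup E] [NormedSpace ℝ E] {τ : E → ℝ}
    {f : E → RLoop ρ} {e : E} (hτ : ContDiffAt ℝ ω τ e) (hf : ContDiffAt ℝ ω f e) :
    ContDiffAt ℝ ω (fun e => (RLoop.ev (exp (I * τ e)) (f e)).re) e := by
  have h1 : ContDiffAt ℝ ω (fun w => (RLoop.ev w : RLoop ρ →L[ℝ] ℂ)) (exp (I * τ e)) :=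
    (RLoop.analyticAt_ev (norm_exp_I_mul (τ e))).restrictScalars.contDiffAt
  have h2 : ContDiffAt ℝ ω (fun e => exp (I * τ e)) e :=
    (contDiffAt_const.mul (ofRealCLM.contDiff.contDiffAt.comp e hτ)).cexp
  have h3 := ContDiffAt.clm_apply (h1.comp e h2) hf
  exact reCLM.contDiff.contDiffAt.comp e h3

theorem ev_lineLoop (s : ℝ) :
    (RLoop.ev (exp (I * (Real.pi / 2 + s * θ : ℝ))) (lineLoop k r g s)).re =
      2 * Real.pi * (1 + s * r) * (k * Real.sin (s * θ) +
        s * (RLoop.ev (exp (I * (Real.pi / 2 + s * θ : ℝ))) (incl g)).re) := by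
  have hz := norm_exp_I_mul (Real.pi / 2 + s * θ)
  -- On the circle λ⁻¹ + λ is twice the cosine of the angle, here 2 cos(π/2 + sθ).
  have h1 : exp (I * (Real.pi / 2 + s * θ : ℝ)) ^ (-1 : ℤ) + exp (I * (Real.pi / 2 + s * θ : ℝ)) =
      ((-2 * Real.sin (s * θ) : ℝ) : ℂ) := by
    rw [zpow_neg_one, ← exp_neg, ← mul_neg, mul_comm, mul_comm I]
    have h2 := Complex.two_cos (Real.pi / 2 + s * θ : ℝ)
    rw [← ofReal_cos, add_comm (Real.pi / 2), Real.cos_add_pi_div_two] at h2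
    rw [add_comm (Real.pi / 2)]
    push_cast at h2 ⊢
    linear_combination -h2
  simp only [lineLoop, map_smul, map_add, RLoop.ev_X hz, zpow_one]
  rw [h1]
  simp only [Complex.real_smul, re_ofReal_mul, add_re, ofReal_re]
  ring

theorem hasDerivAt_ev_lineLoop :
    HasDerivAt (fun s : ℝ => (RLoop.ev (exp (I * (Real.pi / 2 + s * θ : ℝ))) (lineLoop k r g s)).re)
      (2 * Real.pi * (k * θ + (RLoop.ev I (incl g)).re)) 0 := by
  simp only [ev_lineLoop]
  have h1 : HasDerivAt (fun s : ℝ => 2 * Real.pi * (1 + s * r)) (2 * Real.pi * r) 0 := by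
    simpa using (((hasDerivAt_id (0 : ℝ)).mul_const r).const_add 1).const_mul (2 * Real.pi)
  have h2 : HasDerivAt (fun s : ℝ => k * Real.sin (s * θ)) (k * θ) 0 := by
    simpa using (((hasDerivAt_id (0 : ℝ)).mul_const θ).sin).const_mul k
  have h3 := (contDiffAt_ev_exp (e := (0 : ℝ)) (τ := fun s : ℝ => Real.pi / 2 + s * θ)
    (f := fun _ => incl g) (by fun_prop) contDiffAt_const).differentiableAt (by simp)
  have h4 := (hasDerivAt_id (0 : ℝ)).mul h3.hasDerivAt
  refine (h1.mul (h2.add h4)).congr_deriv ?_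
  have h5 : exp (I * ((Real.pi / 2 : ℝ) : ℂ)) = I := by
    rw [mul_comm]
    push_cast
    exact exp_pi_div_two_mul_I
  simp [-ofReal_add, -ofReal_div, h5]

end Line

variable {φ : ℝ} (hP : Real.sin φ ≠ 0) (hQ : Real.sin (Real.pi / 2 - φ) ≠ 0)

theorem pLoop_line (hφ : φ ∈ Ioo 0 (Real.pi / 2)) (h : Param ρ) (s : ℝ) :
    pLoop φ hP (0, central ρ + s • h) = lineLoop (Real.cos φ) h.r h.2.2.1 s := by
  rw [pLoop, parP, hatLoop_zero, integral_segC hφ, lineLoop, loopC, neg_mul_neg, smul_smul]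
  congr 1
  simp [central]

theorem qLoop_line (hφ : φ ∈ Ioo 0 (Real.pi / 2)) (h : Param ρ) (s : ℝ) :
    qLoop φ hQ (0, central ρ + s • h) = lineLoop (Real.sin φ) h.r h.2.1 s := by
  rw [qLoop, parQ, hatLoop_zero, integral_segC ⟨by linarith [hφ.2], by linarith [hφ.1]⟩, lineLoop,
    loopB, neg_mul_neg, smul_smul]
  congr 1
  simp [central]

theorem detLoop_line (h : Param ρ) (s : ℝ) :
    detLoop φ (central ρ + s • h) = (1 - (1 + s * h.r) ^ 2) • RLoop.X 1 +
      (((1 + s * h.r) ^ 2 * s) • (detLoopLin φ h + (2 * h.r) • RLoop.X 1) +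
      ((1 + s * h.r) ^ 2 * s ^ 2) • (RLoop.X 1 * (incl h.1 * incl h.1 - incl h.2.1 * incl h.2.1 -
        incl h.2.2.1 * incl h.2.2.1))) := by
  simp only [detLoop, detLoopLin, Param.r, central, Prod.fst_add, Prod.snd_add, Prod.smul_fst,
    Prod.smul_snd, zero_add, map_smul, smul_eq_mul]
  simp only [Algebra.smul_def, map_mul, map_pow, map_sub, map_add]
  ring

theorem hasDerivAt_trunc_detLoop_line (h : Param ρ) :
    HasDerivAt (fun s : ℝ => trunc (detLoop φ (central ρ + s • h))) (trunc (detLoopLin φ h)) 0 := by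
  refine (trunc (ρ := ρ)).hasFDerivAt.comp_hasDerivAt (0 : ℝ) ?_
  simp only [detLoop_line]
  have h0 : HasDerivAt (fun s : ℝ => (1 + s * h.r) ^ 2) (2 * h.r) 0 := by
    refine ((((hasDerivAt_id (0 : ℝ)).mul_const h.r).const_add 1).pow 2).congr_deriv ?_
    simp
  have h1 := (h0.const_sub 1).smul_const (RLoop.X 1 : RLoop ρ)
  have h2 := (h0.mul (hasDerivAt_id (0 : ℝ))).smul_const (detLoopLin φ h + (2 * h.r) • RLoop.X 1)
  have h3 := (h0.mul ((hasDerivAt_id (0 : ℝ)).pow 2)).smul_const (RLoop.X 1 *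
    (incl h.1 * incl h.1 - incl h.2.1 * incl h.2.1 - incl h.2.2.1 * incl h.2.2.1))
  refine (h1.add (h2.add h3)).congr_deriv ?_
  simp

/-- Differentiability comes from analyticity, so derivatives along lines suffice to identify the
full derivative, and at t = 0 the map is explicit on lines. -/
theorem hasDerivAt_monodromyMap_line (hφ : φ ∈ Ioo 0 (Real.pi / 2)) (h : Param ρ) :
    HasDerivAt (fun s : ℝ => monodromyMap φ hP hQ (0, central ρ + s • h)) (monodromyLin φ h) 0 := by
  have hθ : ∀ s : ℝ, (central ρ + s • h).θ = Real.pi / 2 + s * h.θ := fun s => rfl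
  simp only [monodromyMap, pLoop_line hP hφ, qLoop_line hQ hφ, hθ]
  have h1 := hasDerivAt_skewPart_lineLoop (Real.cos φ) h.r h.2.2.1
  have h2 := hasDerivAt_skewPart_lineLoop (Real.sin φ) h.r h.2.1
  have h3 := hasDerivAt_trunc_detLoop_line (φ := φ) h
  have h4 := hasDerivAt_ev_lineLoop (Real.cos φ) h.r h.θ h.2.2.1
  have h5 := hasDerivAt_ev_lineLoop (Real.sin φ) h.r h.θ h.2.1
  exact h1.prodMk (h2.prodMk (h3.prodMk (h4.prodMk h5)))

theorem monodromyMap_central (hφ : φ ∈ Ioo 0 (Real.pi / 2)) :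
    monodromyMap φ hP hQ (0, central ρ) = 0 := by
  have hp := pLoop_line hP hφ (0 : Param ρ) 0
  have hq := qLoop_line hQ hφ (0 : Param ρ) 0
  have hd := detLoop_line (φ := φ) (0 : Param ρ) 0
  have hep := ev_lineLoop (Real.cos φ) 0 0 (0 : WRNonneg ρ) 0
  have heq := ev_lineLoop (Real.sin φ) 0 0 (0 : WRNonneg ρ) 0
  simp only [smul_zero, add_zero] at hp hq hd
  simp only [zero_mul, add_zero, Real.sin_zero, mul_zero] at hep heq
  simp only [monodromyMap, Prod.mk_eq_zero]
  refine ⟨?_, ?_, ?_, ?_, ?_⟩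
  · rw [hp, skewPart_lineLoop, mul_zero, zero_smul]
  · rw [hq, skewPart_lineLoop, mul_zero, zero_smul]
  · rw [hd]
    simp
  · rw [hp]
    exact hep
  · rw [hq]
    exact heq

theorem contDiff_parP : ContDiff ℝ ω (parP φ : Param ρ → _) := by
  have hi : ContDiff ℝ ω (incl : WRNonneg ρ → RLoop ρ) := (incl (ρ := ρ)).contDiff
  unfold parP loopA loopB loopC Param.r
  fun_prop

theorem contDiff_parQ : ContDiff ℝ ω (parQ φ : Param ρ → _) := by
  have hi : ContDiff ℝ ω (incl : WRNonneg ρ → RLoop ρ) := (incl (ρ := ρ)).contDiff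
  unfold parQ loopA loopB loopC Param.r
  fun_prop

theorem contDiff_detLoop : ContDiff ℝ ω (detLoop φ : Param ρ → _) := by
  have hi : ContDiff ℝ ω (incl : WRNonneg ρ → RLoop ρ) := (incl (ρ := ρ)).contDiff
  unfold detLoop Param.r
  fun_prop

theorem framesSolvable_zero (x : Param ρ) : FramesSolvable φ hP hQ (0, x) :=
  ⟨solvable_zero _ _ _ _, solvable_zero _ _ _ _⟩

theorem isOpen_framesSolvable : IsOpen {q : ℝ × Param ρ | FramesSolvable φ hP hQ q} := by
  have h1 : Continuous fun q : ℝ × Param ρ => (q.1, parP φ q.2) :=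
    continuous_fst.prodMk ((contDiff_parP (ρ := ρ)).continuous.comp continuous_snd)
  have h2 : Continuous fun q : ℝ × Param ρ => (q.1, parQ φ q.2) :=
    continuous_fst.prodMk ((contDiff_parQ (ρ := ρ)).continuous.comp continuous_snd)
  exact ((isOpen_solvable _ _ _).preimage h1).inter ((isOpen_solvable _ _ _).preimage h2)

theorem contDiffAt_monodromyMap {q : ℝ × Param ρ} (h : FramesSolvable φ hP hQ q) :
    ContDiffAt ℝ ω (monodromyMap φ hP hQ) q := by
  have h1 : ContDiffAt ℝ ω (pLoop φ hP) q :=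
    (contDiffAt_hatLoop h.1).comp q (f := fun q : ℝ × Param ρ => (q.1, parP φ q.2))
      (contDiffAt_fst.prodMk ((contDiff_parP (ρ := ρ)).contDiffAt.comp q contDiffAt_snd))
  have h2 : ContDiffAt ℝ ω (qLoop φ hQ) q :=
    (contDiffAt_hatLoop h.2).comp q (f := fun q : ℝ × Param ρ => (q.1, parQ φ q.2))
      (contDiffAt_fst.prodMk ((contDiff_parQ (ρ := ρ)).contDiffAt.comp q contDiffAt_snd))
  have hθ : ContDiffAt ℝ ω (fun q : ℝ × Param ρ => q.2.θ) q := by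
    unfold Param.θ
    fun_prop
  have h3 := (skewPart (ρ := ρ)).contDiff.contDiffAt.comp q h1
  have h4 := (skewPart (ρ := ρ)).contDiff.contDiffAt.comp q h2
  have h5 := (trunc (ρ := ρ)).contDiff.contDiffAt.comp q
    ((contDiff_detLoop (ρ := ρ) (φ := φ)).contDiffAt.comp q contDiffAt_snd)
  exact h3.prodMk (h4.prodMk (h5.prodMk
    ((contDiffAt_ev_exp hθ h1).prodMk (contDiffAt_ev_exp hθ h2))))

theorem fderiv_monodromyMap_inr (hφ : φ ∈ Ioo 0 (Real.pi / 2)) (h : Param ρ) :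
    (fderiv ℝ (monodromyMap φ hP hQ) (0, central ρ) ∘L .inr ℝ ℝ (Param ρ)) h =
      monodromyLin φ h := by
  have h1 := ((contDiffAt_monodromyMap hP hQ
    (framesSolvable_zero hP hQ (central ρ))).differentiableAt (by simp)).hasFDerivAt
  have h2 : HasDerivAt (fun s : ℝ => ((0 : ℝ), central ρ + s • h)) (0, h) 0 := by
    refine (hasDerivAt_const (0 : ℝ) (0 : ℝ)).prodMk ?_
    simpa using ((hasDerivAt_id (0 : ℝ)).smul_const h).const_add (central ρ)
  have h3 := HasFDerivAt.comp_hasDerivAt_of_eq (0 : ℝ) h1 h2 (by simp)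
  exact h3.unique (hasDerivAt_monodromyMap_line hP hQ hφ h)

/-- A bijective bounded operator between Banach spaces has a bounded inverse. -/
theorem isInvertible_fderiv_monodromyMap (hφ : φ ∈ Ioo 0 (Real.pi / 2)) :
    (fderiv ℝ (monodromyMap φ hP hQ) (0, central ρ) ∘L .inr ℝ ℝ (Param ρ)).IsInvertible := by
  have h := fderiv_monodromyMap_inr (ρ := ρ) hP hQ hφ
  refine ⟨ContinuousLinearEquiv.ofBijective _ ?_ ?_, ContinuousLinearEquiv.coe_ofBijective _ _ _⟩
  · refine LinearMap.ker_eq_bot'.2 fun x hx => monodromyLin_injective (φ := φ) ?_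
    rw [← h x]
    exact hx
  · refine LinearMap.range_eq_top.2 fun y => ?_
    obtain ⟨x, hx⟩ := monodromyLin_surjective φ y
    exact ⟨x, (h x).trans hx⟩

end Implicit

end DPW

end

/-! ### The family of solutions from the implicit function theorem -/

theorem mainTheorem9 (ρ : ℝ) [Fact (1 < ρ)] (φ : ℝ) (hφ : φ ∈ Set.Ioo 0 (Real.pi / 2)) :
    ∃ ε > 0, ∃ U ∈ 𝓝 (DPW.central ρ), ∃ x : ℝ → DPW.Param ρ,
      x 0 = DPW.central ρ ∧
      AnalyticOnNhd ℝ x (Set.Ioo (-ε) ε) ∧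
      ∀ t ∈ Set.Ioo (-ε) ε,
        x t ∈ U ∧
        DPW.IsSymmetric φ (DPW.potential φ t (x t)) ∧
        (t ≠ 0 → DPW.IsDPWPotential φ (DPW.potential φ t (x t))) ∧
        DPW.SolvesMonodromyProblem φ t (x t) ∧
        ∀ y ∈ U, DPW.SolvesMonodromyProblem φ t y → y = x t := by
  have hP : Real.sin φ ≠ 0 :=
    (Real.sin_pos_of_pos_of_lt_pi hφ.1 (by linarith [hφ.2, Real.pi_pos])).ne'
  have hQ : Real.sin (Real.pi / 2 - φ) ≠ 0 :=
    (Real.sin_pos_of_pos_of_lt_pi (by linarith [hφ.2]) (by linarith [hφ.1, Real.pi_pos])).ne'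
  have hcd := DPW.contDiffAt_monodromyMap hP hQ (DPW.framesSolvable_zero hP hQ (DPW.central ρ))
  have hinv := DPW.isInvertible_fderiv_monodromyMap (ρ := ρ) hP hQ hφ
  -- The smoothness exponent `⊤` in `WithTop ℕ∞` is `ω`, so the implicit function is real analytic.
  have hω : (⊤ : WithTop ℕ∞) ≠ 0 := by simp
  set x := hcd.implicitFunction hω hinv with hx
  have hx0 : x 0 = DPW.central ρ := hcd.implicitFunction_apply_self hω hinv
  have hana : AnalyticAt ℝ x 0 := (hcd.contDiffAt_implicitFunction hω hinv).analyticAt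
  have hiff := hcd.eventually_apply_eq_iff_implicitFunction hω hinv
  rw [DPW.monodromyMap_central hP hQ hφ] at hiff
  have hgood : ∀ᶠ v in 𝓝 ((0 : ℝ), DPW.central ρ), DPW.FramesSolvable φ hP hQ v ∧
      v.2.θ ∈ Ioo 0 Real.pi ∧ 0 < v.2.r := by
    have h0 : ∀ᶠ v in 𝓝 ((0 : ℝ), DPW.central ρ), DPW.FramesSolvable φ hP hQ v :=
      (DPW.isOpen_framesSolvable hP hQ).mem_nhds (DPW.framesSolvable_zero hP hQ _)
    refine h0.and (Filter.Eventually.and ?_ ?_)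
    · have hc : Continuous fun v : ℝ × DPW.Param ρ => v.2.θ := by
        unfold DPW.Param.θ
        fun_prop
      refine (isOpen_Ioo.preimage hc).mem_nhds ?_
      exact ⟨half_pos Real.pi_pos, half_lt_self Real.pi_pos⟩
    · have hc : Continuous fun v : ℝ × DPW.Param ρ => v.2.r := by
        unfold DPW.Param.r
        fun_prop
      exact (isOpen_Ioi.preimage hc).mem_nhds (one_pos : (0 : ℝ) < 1)
  -- On a box T × U the zeros are exactly the graph of x, and the solvability and sign conditions
  -- hold; U then serves uniformly in t for existence and uniqueness.
  obtain ⟨T, hT, U, hU, hTU⟩ := mem_nhds_prod_iff.1 (hiff.and hgood)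
  have hxU : ∀ᶠ t in 𝓝 (0 : ℝ), x t ∈ U := hana.continuousAt (hx0.symm ▸ hU)
  obtain ⟨ε, hε, hball⟩ := Metric.eventually_nhds_iff_ball.1
    ((hxU.and hana.eventually_analyticAt).and hT)
  rw [Real.ball_eq_Ioo, zero_sub, zero_add] at hball
  refine ⟨ε, hε, U, hU, x, hx0, fun t ht => (hball t ht).1.2, fun t ht => ?_⟩
  have hxt := (hball t ht).1.1
  obtain ⟨h1, h2, h3, h4⟩ := hTU (mk_mem_prod (hball t ht).2 hxt)
  refine ⟨hxt, DPW.isSymmetric_potential φ t (x t), fun ht0 =>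
    DPW.isDPWPotential_potential hφ (mul_ne_zero h4.ne' ht0), ?_, fun y hy hsol => ?_⟩
  · exact (DPW.solvesMonodromyProblem_iff hP hQ h2).2 ⟨h3, h1.2 rfl⟩
  · obtain ⟨k1, k2, -⟩ := hTU (mk_mem_prod (hball t ht).2 hy)
    exact (k1.1 ((DPW.solvesMonodromyProblem_iff hP hQ k2).1 hsol).2).symm
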